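/- Let $H\in C(\mathbb R)$ be coercive, i.e. $H(p)\to+\infty$ as $|p|\to\infty$, and let $V_1,V_2\in C(\mathbb T)$, $\mathbb T=\mathbb R/\mathbb Z$ (that is, continuous $1$-periodic functions on $\mathbb R$). For $i=1,2$ and $p\in\mathbb R$ let $\overline H_i(p)$ be the effective Hamiltonian of $H(p)+V_i(x)$: the unique constant $c\in\mathbb R$ for which the cell problem $$H(p+v')+V_i(x)=c\quad\text{in }\mathbb T$$ has a viscosity solution $v\in C(\mathbb T)$. Say that $V_1$ and $V_2$ have the same distribution if $\int_0^1 f(V_1(x))\,dx=\int_0^1 f(V_2(x))\,dx$ for every $f\in C(\mathbb R)$. Call $H$ quasi-convex if $\{p\in\mathbb R: H(p)\le s\}$ is convex for every $s\in\mathbb R$. Call $H$ strongly superlinear if there is $a\in\mathbb R$ such that the restriction of $H$ to $[a,+\infty)$ is smooth and strictly increasing and its inverse $\psi:[H(a),+\infty)\to[a,+\infty)$ satisfies $$\lim_{x\to+\infty}\frac{\psi^{(k)}(x)}{\psi^{(k-1)}(x)}=0\quad\text{for all } k\ge 1,$$ where it is understood that for each $k$ the derivatives in the quotient exist and the denominator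 is nonzero for all sufficiently large $x$. **Theorem.** (1) If $H$ is quasi-convex and $V_1$ and $V_2$ have the same distribution, then $\overline H_1(p)=\overline H_2(p)$ for all $p\in\mathbb R$. (2) If $H$ is strongly superlinear and $\overline H_1(p)=\overline H_2(p)$ for all $p\in\mathbb R$, then $V_1$ and $V_2$ have the same distribution. -/

import Mathlib

open Set Filter Topology
open scoped ContDiff

/-- Coercivity: `H(p) → +∞` as `|p| → ∞`. -/
def Coercive (H : ℝ → ℝ) : Prop :=
  Tendsto H (cocompact ℝ) atTop

/-- `v` is a viscosity subsolution on `ℝ` of `H(p + v') + V(x) = c`. -/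
def IsViscositySubsolution (H V : ℝ → ℝ) (p c : ℝ) (v : ℝ → ℝ) : Prop :=
  ∀ φ : ℝ → ℝ, ContDiff ℝ 1 φ → ∀ x : ℝ, IsLocalMax (fun y => v y - φ y) x →
    H (p + deriv φ x) + V x ≤ c

/-- `v` is a viscosity supersolution on `ℝ` of `H(p + v') + V(x) = c`. -/
def IsViscositySupersolution (H V : ℝ → ℝ) (p c : ℝ) (v : ℝ → ℝ) : Prop :=
  ∀ φ : ℝ → ℝ, ContDiff ℝ 1 φ → ∀ x : ℝ, IsLocalMin (fun y => v y - φ y) x →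
    c ≤ H (p + deriv φ x) + V x

/-- The pair `(v, c)` solves the cell problem `H(p + v') + V(x) = c` on the torus `𝕋 = ℝ/ℤ`:
`v` is continuous, `1`-periodic, and a viscosity solution. -/
structure IsCellSolution (H V : ℝ → ℝ) (p c : ℝ) (v : ℝ → ℝ) : Prop where
  continuous : Continuous v
  periodic : Function.Periodic v 1
  subsolution : IsViscositySubsolution H V p c v
  supersolution : IsViscositySupersolution H V p c v

open Classical in
/-- The effective Hamiltonian of `H(p) + V(x)` at `p`: the unique constant `c` for which the cell
problem has a solution. For `H` continuous and coercive and `V` continuous and `1`-periodic there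
is exactly one such `c`, so that the value `0` of the other branch is never taken. -/
noncomputable def effectiveHamiltonian (H V : ℝ → ℝ) (p : ℝ) : ℝ :=
  if h : ∃! c : ℝ, ∃ v : ℝ → ℝ, IsCellSolution H V p c v then h.choose else 0

/-- `V₁` and `V₂` have the same distribution. -/
def SameDistribution (V₁ V₂ : ℝ → ℝ) : Prop :=
  ∀ f : ℝ → ℝ, Continuous f → ∫ x in (0 : ℝ)..1, f (V₁ x) = ∫ x in (0 : ℝ)..1, f (V₂ x)

/-- The inverse `ψ : [H(a), ∞) → [a, ∞)` of the restriction of `H` to `[a, ∞)` (its values outside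
`[H(a), ∞)` are irrelevant). -/
noncomputable def branchInverse (H : ℝ → ℝ) (a : ℝ) : ℝ → ℝ :=
  Function.invFunOn H (Ici a)

/-- `H` is strongly superlinear: for some `a`, the restriction of `H` to `[a, ∞)` is smooth, strictly
increasing, onto `[H(a), ∞)`, and its inverse `ψ` satisfies `ψ⁽ᵏ⁾(x) / ψ⁽ᵏ⁻¹⁾(x) → 0` as `x → +∞`
for every `k ≥ 1`. That the derivatives exist and the quotients are meaningful for large `x` is
spelled out. -/
def StronglySuperlinear (H : ℝ → ℝ) : Prop :=
  ∃ a : ℝ, ContDiffOn ℝ ∞ H (Ici a) ∧ StrictMonoOn H (Ici a) ∧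
    SurjOn H (Ici a) (Ici (H a)) ∧
    ∀ k : ℕ, 1 ≤ k →
      (∀ᶠ x in atTop, ContDiffAt ℝ k (branchInverse H a) x ∧
        iteratedDeriv (k - 1) (branchInverse H a) x ≠ 0) ∧
      Tendsto (fun x => iteratedDeriv k (branchInverse H a) x /
        iteratedDeriv (k - 1) (branchInverse H a) x) atTop (𝓝 0)

/-!
A selection `g` of `H (g) + V = c` with mean `p` yields the corrector `v (x) = ∫₀ˣ (g - p)`, which is
the only kind of solution that is needed. If `g` is continuous, `v` is a classical solution and may
be used as a test function against any other viscosity solution; hence the cell constant is `c`, and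
continuous `g` for which the equation holds with `≤` or `≥` bound the cell constant from one side
(`IsCellSolution.le_of_forall_le`, `IsCellSolution.ge_of_forall_ge`). No doubling of variables is
involved.

For quasi-convex `H` with minimum point `m`, the level `c` of a mean momentum `p` is described by the
generalized inverses of `H` on the two sides of `m`. Either some selection on one side of `m` has
mean `p` (`IsRightLevel`, applied to `H` or to `q ↦ H (-q)`), or `c = min H + max V` and `p` lies
between the means of the two branches (`IsFlatLevel`). A solution is the corrector of a possibly
discontinuous selection (`isCellSolution_corrector`), and uniqueness of `c` follows by comparison
with continuous approximate selections, obtained by averaging the generalized inverse over short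
intervals of levels. These descriptions mention `V` only through averages `∫ K (c - V)` with `K`
monotone and through the upper bounds of `V`, so they depend only on the distribution of `V`.

For strongly superlinear `H` with inverse `ψ` near `+∞`, the level `c` is attained for large `c` at
`p = ∫ ψ (c - V)`, so equal effective Hamiltonians give `∫ ψ (c - V₁) = ∫ ψ (c - V₂)` for all large
`c` (`eventually_integral_eq`). Because `ψ⁽ᵏ⁺¹⁾ / ψ⁽ᵏ⁾ → 0`, each derivative of `ψ` varies slowly over
bounded windows and dominates the Taylor remainder that follows it; dividing the expansion of order
`n` by `ψ⁽ⁿ⁾(c)` shows by induction that the `n`-th moments of the potentials agree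
(`integral_pow_eq_of_eventually_integral_eq`). The moments determine the distribution by the
Weierstrass approximation theorem.
-/

/-! ### Correctors and their slopes at touching points -/

theorem Function.Periodic.exists_forall_le_of_continuous {f : ℝ → ℝ} (hf : Continuous f)
    (hper : Function.Periodic f 1) : ∃ x₀, ∀ x, f x ≤ f x₀ := by
  obtain ⟨x₀, -, hx₀⟩ := isCompact_Icc.exists_isMaxOn (nonempty_Icc.2 zero_le_one)
    (hf.continuousOn (s := Icc (0 : ℝ) 1))
  refine ⟨x₀, fun x => ?_⟩
  obtain ⟨y, hy, hxy⟩ := hper.exists_mem_Ico₀ one_pos x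
  rw [hxy]
  exact hx₀ (Ico_subset_Icc_self hy)

/-- The corrector `x ↦ ∫₀ˣ (g - p)`, whose momentum `p + v'` is `g`. -/
noncomputable def corrector (g : ℝ → ℝ) (p x : ℝ) : ℝ :=
  ∫ y in (0 : ℝ)..x, (g y - p)

section Corrector

variable {g : ℝ → ℝ} {p : ℝ}

theorem corrector_sub (hg : ∀ a b, IntervalIntegrable g MeasureTheory.volume a b) (x y : ℝ) :
    corrector g p y - corrector g p x = ∫ t in x..y, (g t - p) := by
  have h : ∀ a b, IntervalIntegrable (fun t => g t - p) MeasureTheory.volume a b := fun a b =>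
    (hg a b).sub intervalIntegrable_const
  exact intervalIntegral.integral_interval_sub_left (h _ _) (h _ _)

theorem periodic_corrector (hg : ∀ a b, IntervalIntegrable g MeasureTheory.volume a b)
    (hper : Function.Periodic g 1) (hp : ∫ x in (0 : ℝ)..1, g x = p) :
    Function.Periodic (corrector g p) 1 := by
  intro x
  have hper' : Function.Periodic (fun t => g t - p) 1 := fun t => by simp [hper t]
  have h := hper'.intervalIntegral_add_eq x 0
  rw [← corrector_sub hg, zero_add, intervalIntegral.integral_sub (hg _ _) intervalIntegrable_const,
    hp] at h
  simp at h
  linarith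

theorem continuous_corrector (hg : ∀ a b, IntervalIntegrable g MeasureTheory.volume a b) :
    Continuous (corrector g p) :=
  intervalIntegral.continuous_primitive
    (fun a b => (hg a b).sub intervalIntegrable_const) 0

theorem hasDerivAt_corrector (hg : Continuous g) (x : ℝ) :
    HasDerivAt (corrector g p) (g x - p) x :=
  intervalIntegral.integral_hasDerivAt_right ((hg.sub continuous_const).intervalIntegrable _ _)
    (hg.sub continuous_const).stronglyMeasurable.stronglyMeasurableAtFilter
    (hg.sub continuous_const).continuousAt

theorem contDiff_corrector (hg : Continuous g) : ContDiff ℝ 1 (corrector g p) := by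
  have hd : deriv (corrector g p) = fun x => g x - p :=
    funext fun x => (hasDerivAt_corrector hg x).deriv
  rw [contDiff_one_iff_deriv]
  exact ⟨fun x => (hasDerivAt_corrector hg x).differentiableAt, by rw [hd]; fun_prop⟩

theorem corrector_sub_le (hg : ∀ a b, IntervalIntegrable g MeasureTheory.volume a b)
    {x y q : ℝ} (hxy : x ≤ y) (h : ∀ t ∈ Ioo x y, g t ≤ q) :
    corrector g p y - corrector g p x ≤ (q - p) * (y - x) := by
  rw [corrector_sub hg]
  have := intervalIntegral.integral_mono_on_of_le_Ioo hxy
    ((hg x y).sub (intervalIntegrable_const (c := p))) (intervalIntegrable_const (c := q - p))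
    (fun t ht => sub_le_sub_right (h t ht) p)
  rw [intervalIntegral.integral_const, smul_eq_mul, mul_comm] at this
  exact this

theorem le_corrector_sub (hg : ∀ a b, IntervalIntegrable g MeasureTheory.volume a b)
    {x y q : ℝ} (hxy : x ≤ y) (h : ∀ t ∈ Ioo x y, q ≤ g t) :
    (q - p) * (y - x) ≤ corrector g p y - corrector g p x := by
  rw [corrector_sub hg]
  have := intervalIntegral.integral_mono_on_of_le_Ioo hxy
    (intervalIntegrable_const (c := q - p)) ((hg x y).sub (intervalIntegrable_const (c := p)))
    (fun t ht => sub_le_sub_right (h t ht) p)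
  rw [intervalIntegral.integral_const, smul_eq_mul, mul_comm] at this
  exact this

end Corrector

section Slopes

variable {φ : ℝ → ℝ} {x K : ℝ}

theorem deriv_le_of_eventually_left (hφ : DifferentiableAt ℝ φ x)
    (h : ∀ᶠ y in 𝓝[<] x, φ x - φ y ≤ K * (x - y)) : deriv φ x ≤ K := by
  have ht := (hasDerivAt_iff_tendsto_slope.1 hφ.hasDerivAt).mono_left
    (nhdsWithin_mono x (fun y (hy : y < x) => hy.ne))
  refine le_of_tendsto (x := 𝓝[<] x) ht ?_
  filter_upwards [h, self_mem_nhdsWithin] with y hy hyx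
  have hyx : y < x := hyx
  rw [slope_comm, slope_def_field, div_le_iff₀ (by linarith)]
  exact hy

theorem le_deriv_of_eventually_right (hφ : DifferentiableAt ℝ φ x)
    (h : ∀ᶠ y in 𝓝[>] x, K * (y - x) ≤ φ y - φ x) : K ≤ deriv φ x := by
  have ht := (hasDerivAt_iff_tendsto_slope.1 hφ.hasDerivAt).mono_left
    (nhdsWithin_mono x (fun y (hy : x < y) => hy.ne'))
  refine ge_of_tendsto (x := 𝓝[>] x) ht ?_
  filter_upwards [h, self_mem_nhdsWithin] with y hy hyx
  have hyx : x < y := hyx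
  rw [slope_def_field, le_div_iff₀ (by linarith)]
  exact hy

theorem le_deriv_of_eventually_left (hφ : DifferentiableAt ℝ φ x)
    (h : ∀ᶠ y in 𝓝[<] x, K * (x - y) ≤ φ x - φ y) : K ≤ deriv φ x := by
  have := deriv_le_of_eventually_left (K := -K) hφ.neg (h.mono fun y hy => by simp; linarith)
  rw [deriv.neg] at this
  linarith

theorem deriv_le_of_eventually_right (hφ : DifferentiableAt ℝ φ x)
    (h : ∀ᶠ y in 𝓝[>] x, φ y - φ x ≤ K * (y - x)) : deriv φ x ≤ K := by
  have := le_deriv_of_eventually_right (K := -K) hφ.neg (h.mono fun y hy => by simp; linarith)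
  rw [deriv.neg] at this
  linarith

end Slopes

theorem eventually_left_forall_Ioo {P : ℝ → Prop} {x : ℝ} (h : ∀ᶠ y in 𝓝[<] x, P y) :
    ∀ᶠ y in 𝓝[<] x, ∀ t ∈ Ioo y x, P t := by
  obtain ⟨l, hl, hlx⟩ := (mem_nhdsLT_iff_exists_Ioo_subset).1 h
  filter_upwards [Ioo_mem_nhdsLT hl] with y hy t ht
  exact hlx ⟨hy.1.trans ht.1, ht.2⟩

theorem eventually_right_forall_Ioo {P : ℝ → Prop} {x : ℝ} (h : ∀ᶠ y in 𝓝[>] x, P y) :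
    ∀ᶠ y in 𝓝[>] x, ∀ t ∈ Ioo x y, P t := by
  obtain ⟨u, hu, hxu⟩ := (mem_nhdsGT_iff_exists_Ioo_subset).1 h
  filter_upwards [Ioo_mem_nhdsGT hu] with y hy t ht
  exact hxu ⟨ht.1, ht.2.trans hy.2⟩

section Touching

variable {g φ : ℝ → ℝ} {p x q : ℝ}

theorem slope_le_of_isLocalMax (hg : ∀ a b, IntervalIntegrable g MeasureTheory.volume a b)
    (hφ : DifferentiableAt ℝ φ x) (hx : IsLocalMax (fun y => corrector g p y - φ y) x)
    (h : ∀ᶠ y in 𝓝[<] x, g y ≤ q) : p + deriv φ x ≤ q := by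
  suffices deriv φ x ≤ q - p by linarith
  refine deriv_le_of_eventually_left hφ ?_
  filter_upwards [eventually_left_forall_Ioo h, self_mem_nhdsWithin,
    hx.filter_mono nhdsWithin_le_nhds] with y hy hyx hmax
  have := corrector_sub_le (p := p) hg (le_of_lt hyx) hy
  linarith

theorem le_slope_of_isLocalMax (hg : ∀ a b, IntervalIntegrable g MeasureTheory.volume a b)
    (hφ : DifferentiableAt ℝ φ x) (hx : IsLocalMax (fun y => corrector g p y - φ y) x)
    (h : ∀ᶠ y in 𝓝[>] x, q ≤ g y) : q ≤ p + deriv φ x := by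
  suffices q - p ≤ deriv φ x by linarith
  refine le_deriv_of_eventually_right hφ ?_
  filter_upwards [eventually_right_forall_Ioo h, self_mem_nhdsWithin,
    hx.filter_mono nhdsWithin_le_nhds] with y hy hyx hmax
  have := le_corrector_sub (p := p) hg (le_of_lt hyx) hy
  linarith

theorem le_slope_of_isLocalMin (hg : ∀ a b, IntervalIntegrable g MeasureTheory.volume a b)
    (hφ : DifferentiableAt ℝ φ x) (hx : IsLocalMin (fun y => corrector g p y - φ y) x)
    (h : ∀ᶠ y in 𝓝[<] x, q ≤ g y) : q ≤ p + deriv φ x := by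
  suffices q - p ≤ deriv φ x by linarith
  refine le_deriv_of_eventually_left hφ ?_
  filter_upwards [eventually_left_forall_Ioo h, self_mem_nhdsWithin,
    hx.filter_mono nhdsWithin_le_nhds] with y hy hyx hmin
  have := le_corrector_sub (p := p) hg (le_of_lt hyx) hy
  linarith

theorem slope_le_of_isLocalMin (hg : ∀ a b, IntervalIntegrable g MeasureTheory.volume a b)
    (hφ : DifferentiableAt ℝ φ x) (hx : IsLocalMin (fun y => corrector g p y - φ y) x)
    (h : ∀ᶠ y in 𝓝[>] x, g y ≤ q) : p + deriv φ x ≤ q := by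
  suffices deriv φ x ≤ q - p by linarith
  refine deriv_le_of_eventually_right hφ ?_
  filter_upwards [eventually_right_forall_Ioo h, self_mem_nhdsWithin,
    hx.filter_mono nhdsWithin_le_nhds] with y hy hyx hmin
  have := corrector_sub_le (p := p) hg (le_of_lt hyx) hy
  linarith

end Touching

/-! ### Comparison and verification for the cell problem -/

section CellConstant

variable {H V g w : ℝ → ℝ} {p c C m : ℝ}

/-- Comparison with a `C¹` subsolution: the corrector of `g` is itself an admissible test function at
a minimum point of the difference. -/
theorem IsCellSolution.le_of_forall_le (hw : IsCellSolution H V p c w) (hg : Continuous g)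
    (hper : Function.Periodic g 1) (hp : ∫ x in (0 : ℝ)..1, g x = p)
    (h : ∀ x, H (g x) + V x ≤ C) : c ≤ C := by
  have hgi : ∀ a b, IntervalIntegrable g MeasureTheory.volume a b := hg.intervalIntegrable
  obtain ⟨x, hx⟩ := Function.Periodic.exists_forall_le_of_continuous
    (f := fun x => corrector g p x - w x) ((continuous_corrector hgi).sub hw.continuous)
    ((periodic_corrector hgi hper hp).sub hw.periodic)
  have h1 := hw.supersolution (corrector g p) (contDiff_corrector hg) x
    (Eventually.of_forall fun y => by have := hx y; simp only at this ⊢; linarith)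
  rw [(hasDerivAt_corrector hg x).deriv, add_sub_cancel] at h1
  exact h1.trans (h x)

/-- Comparison with a `C¹` supersolution. -/
theorem IsCellSolution.ge_of_forall_ge (hw : IsCellSolution H V p c w) (hg : Continuous g)
    (hper : Function.Periodic g 1) (hp : ∫ x in (0 : ℝ)..1, g x = p)
    (h : ∀ x, C ≤ H (g x) + V x) : C ≤ c := by
  have hgi : ∀ a b, IntervalIntegrable g MeasureTheory.volume a b := hg.intervalIntegrable
  obtain ⟨x, hx⟩ := Function.Periodic.exists_forall_le_of_continuous
    (f := fun x => w x - corrector g p x) (hw.continuous.sub (continuous_corrector hgi))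
    (hw.periodic.sub (periodic_corrector hgi hper hp))
  have h1 := hw.subsolution (corrector g p) (contDiff_corrector hg) x
    (Eventually.of_forall fun y => hx y)
  rw [(hasDerivAt_corrector hg x).deriv, add_sub_cancel] at h1
  exact (h x).trans h1

/-- Lower bound for the cell constant: close to any point of the torus there are points where
the solution is touched from above by a steep parabola. -/
theorem IsCellSolution.min_add_le (hw : IsCellSolution H V p c w) (hV : Continuous V)
    (hm : ∀ q, H m ≤ H q) (x₀ : ℝ) : H m + V x₀ ≤ c := by
  by_contra! hlt
  obtain ⟨r, hr, hball⟩ := Metric.eventually_nhds_iff.1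
    ((hV.tendsto x₀).eventually (lt_mem_nhds (show c - H m < V x₀ by linarith)))
  obtain ⟨z, hz⟩ := hw.periodic.exists_forall_le_of_continuous hw.continuous
  -- The parabola is so steep that it exceeds the oscillation of `w` at distance `s` from `x₀`.
  set s := r / 2 with hs
  have hs0 : 0 < s := by positivity
  set K := (w z - w x₀ + 1) / s ^ 2 with hK
  have hKs : K * s ^ 2 = w z - w x₀ + 1 := by rw [hK]; field_simp
  have hφ : ContDiff ℝ 1 (fun y : ℝ => K * (y - x₀) ^ 2) := by fun_prop
  obtain ⟨y, hy, hmax⟩ := isCompact_Icc.exists_isMaxOn (s := Icc (x₀ - s) (x₀ + s))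
    (nonempty_Icc.2 (by linarith)) (hw.continuous.sub hφ.continuous).continuousOn
  have h0 : w x₀ ≤ w y - K * (y - x₀) ^ 2 := by
    have : w x₀ - K * (x₀ - x₀) ^ 2 ≤ w y - K * (y - x₀) ^ 2 :=
      hmax (show x₀ ∈ Icc (x₀ - s) (x₀ + s) from ⟨by linarith, by linarith⟩)
    simpa using this
  have hne : (y - x₀) ^ 2 ≠ s ^ 2 := by
    intro h
    rw [h, hKs] at h0
    linarith [hz y]
  have hy1 : x₀ - s < y := lt_of_le_of_ne hy.1 fun h => hne (by rw [← h]; ring)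
  have hy2 : y < x₀ + s := lt_of_le_of_ne hy.2 fun h => hne (by rw [h]; ring)
  have h1 := hw.subsolution _ hφ y (hmax.isLocalMax (Icc_mem_nhds hy1 hy2))
  have h2 := hball (y := y) (by rw [Real.dist_eq, abs_lt]; constructor <;> linarith)
  linarith [hm (p + deriv (fun y : ℝ => K * (y - x₀) ^ 2) y)]

theorem effectiveHamiltonian_eq (hw : IsCellSolution H V p c w)
    (huniq : ∀ c' v, IsCellSolution H V p c' v → c' = c) : effectiveHamiltonian H V p = c := by
  have h : ∃! c : ℝ, ∃ v : ℝ → ℝ, IsCellSolution H V p c v :=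
    ⟨c, ⟨w, hw⟩, fun c' ⟨v, hv⟩ => huniq c' v hv⟩
  rw [effectiveHamiltonian, dif_pos h]
  exact h.unique h.choose_spec.1 ⟨w, hw⟩

/-- Verification: the corrector of a possibly discontinuous selection `g` is a viscosity solution. At
a touching point the slope is controlled by the values of `g` on either side. For the supersolution
inequality it is enough that near the point `g` solves the equation along the increasing branch on
the left, or along the decreasing branch on the right, or that the minimum of `H` already satisfies
it. -/
theorem isCellSolution_corrector (hH : Continuous H) (hV : Continuous V)
    (hanti : AntitoneOn H (Iic m)) (hmono : MonotoneOn H (Ici m))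
    (hg : ∀ a b, IntervalIntegrable g MeasureTheory.volume a b)
    (hper : Function.Periodic g 1) (hp : ∫ x in (0 : ℝ)..1, g x = p)
    (hsub : ∀ x, H (g x) + V x ≤ c)
    (hsuper : ∀ x, c ≤ H m + V x ∨
      (∀ᶠ y in 𝓝[<] x, m ≤ g y ∧ c ≤ H (g y) + V y) ∨
      (∀ᶠ y in 𝓝[>] x, g y ≤ m ∧ c ≤ H (g y) + V y)) :
    IsCellSolution H V p c (corrector g p) := by
  have hmin : ∀ q, H m ≤ H q := fun q => (le_total m q).elim
    (fun h => hmono self_mem_Ici h h) (fun h => hanti h self_mem_Iic h)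
  have hnear : ∀ q x, ∀ᶠ y in 𝓝 x, H q + V x < c → H q + V y < c := fun q x => by
    by_cases h : H q + V x < c
    · exact ((hV.tendsto x).eventually (gt_mem_nhds (show V x < c - H q by linarith))).mono
        fun y hy _ => by linarith
    · exact Eventually.of_forall fun y h' => absurd h' h
  have hnear' : ∀ q x, ∀ᶠ y in 𝓝 x, c < H q + V x → c < H q + V y := fun q x => by
    by_cases h : c < H q + V x
    · exact ((hV.tendsto x).eventually (lt_mem_nhds (show c - H q < V x by linarith))).mono
        fun y hy _ => by linarith
    · exact Eventually.of_forall fun y h' => absurd h' h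
  refine ⟨continuous_corrector hg, periodic_corrector hg hper hp, ?_, ?_⟩
  · intro φ hφ x hx
    have hφx := hφ.differentiable one_ne_zero x
    by_contra! hlt
    have hmx : H m + V x ≤ c := by linarith [hmin (g x), hsub x]
    set q := p + deriv φ x with hq
    have hcont : ∀ᶠ q' in 𝓝 q, c < H q' + V x :=
      ((hH.add continuous_const).tendsto q).eventually (lt_mem_nhds hlt)
    rcases lt_trichotomy q m with hqm | hqm | hqm
    · obtain ⟨q', h1, h2⟩ :=
        ((hcont.filter_mono nhdsWithin_le_nhds).and (Ioo_mem_nhdsGT hqm)).exists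
      refine absurd (le_slope_of_isLocalMax (q := q') hg hφx hx ?_) (not_le.2 h2.1)
      filter_upwards [(hnear' q' x).filter_mono nhdsWithin_le_nhds] with y hy
      by_contra! hgy
      have := hanti (hgy.le.trans h2.2.le) h2.2.le hgy.le
      linarith [hy h1, hsub y]
    · rw [hqm] at hlt; linarith
    · obtain ⟨q', h1, h2⟩ :=
        ((hcont.filter_mono nhdsWithin_le_nhds).and (Ioo_mem_nhdsLT hqm)).exists
      refine absurd (slope_le_of_isLocalMax (q := q') hg hφx hx ?_) (not_le.2 h2.2)
      filter_upwards [(hnear' q' x).filter_mono nhdsWithin_le_nhds] with y hy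
      by_contra! hgy
      have := hmono h2.1.le (h2.1.le.trans hgy.le) hgy.le
      linarith [hy h1, hsub y]
  · intro φ hφ x hx
    have hφx := hφ.differentiable one_ne_zero x
    by_contra! hlt
    set q := p + deriv φ x with hq
    have hcont : ∀ᶠ q' in 𝓝 q, H q' + V x < c :=
      ((hH.add continuous_const).tendsto q).eventually (gt_mem_nhds hlt)
    rcases hsuper x with h | h | h
    · linarith [hmin q]
    · obtain ⟨q', h1, h2⟩ := ((hcont.filter_mono nhdsWithin_le_nhds).and
        (self_mem_nhdsWithin (s := Ioi q))).exists
      refine absurd (le_slope_of_isLocalMin (q := q') hg hφx hx ?_) (not_le.2 h2)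
      filter_upwards [(hnear q' x).filter_mono nhdsWithin_le_nhds, h] with y hy hgy
      by_contra! hlt'
      have := hmono hgy.1 (hgy.1.trans hlt'.le) hlt'.le
      linarith [hy h1, hgy.2]
    · obtain ⟨q', h1, h2⟩ := ((hcont.filter_mono nhdsWithin_le_nhds).and
        (self_mem_nhdsWithin (s := Iio q))).exists
      refine absurd (slope_le_of_isLocalMin (q := q') hg hφx hx ?_) (not_le.2 h2)
      filter_upwards [(hnear q' x).filter_mono nhdsWithin_le_nhds, h] with y hy hgy
      by_contra! hlt'
      have := hanti (hlt'.le.trans hgy.1) hgy.1 hlt'.le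
      linarith [hy h1, hgy.2]

end CellConstant

/-! ### Branches of a quasi-convex Hamiltonian -/

theorem exists_antitoneOn_monotoneOn {H : ℝ → ℝ} (hH : Continuous H) (hcoer : Coercive H)
    (hq : QuasiconvexOn ℝ univ H) : ∃ m, AntitoneOn H (Iic m) ∧ MonotoneOn H (Ici m) := by
  obtain ⟨m, hm⟩ := hH.exists_forall_le hcoer
  have hseg : ∀ r x y z, H x ≤ r → H y ≤ r → x ≤ z → z ≤ y → H z ≤ r := by
    intro r x y z hx hy hxz hzy
    exact ((hq r).ordConnected.out (x := x) (y := y) ⟨trivial, hx⟩ ⟨trivial, hy⟩ ⟨hxz, hzy⟩).2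
  refine ⟨m, fun a _ b hb hab => ?_, fun a ha b _ hab => ?_⟩
  · exact hseg (H a) a m b le_rfl (hm a) hab hb
  · exact hseg (H b) m b a (hm b) le_rfl ha hab

/-- The least point of `[m, ∞)` at which `H` reaches the level `s`: the left-continuous generalized
inverse of `H` on `[m, ∞)`. It equals `m` for `s ≤ H m`. -/
noncomputable def lowerBranch (H : ℝ → ℝ) (m s : ℝ) : ℝ :=
  sInf {q | m ≤ q ∧ s ≤ H q}

/-- The infimum of the points of `[m, ∞)` at which `H` exceeds the level `s`: the right-continuous
generalized inverse of `H` on `[m, ∞)`. It equals `m` for `s < H m`. The two inverses differ at the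
levels at which `H` is flat. -/
noncomputable def upperBranch (H : ℝ → ℝ) (m s : ℝ) : ℝ :=
  sInf {q | m ≤ q ∧ s < H q}

section Branches

variable {H : ℝ → ℝ} {m : ℝ}

theorem bddBelow_branch (P : ℝ → Prop) : BddBelow {q | m ≤ q ∧ P q} := ⟨m, fun _ h => h.1⟩

theorem nonempty_branch (htop : Tendsto H atTop atTop) (s : ℝ) : {q | m ≤ q ∧ s < H q}.Nonempty :=
  ((eventually_ge_atTop m).and (htop.eventually_gt_atTop s)).exists

theorem nonempty_branch' (htop : Tendsto H atTop atTop) (s : ℝ) :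
    {q | m ≤ q ∧ s ≤ H q}.Nonempty :=
  (nonempty_branch htop s).mono fun _ h => ⟨h.1, h.2.le⟩

theorem le_lowerBranch (htop : Tendsto H atTop atTop) (s : ℝ) : m ≤ lowerBranch H m s :=
  le_csInf (nonempty_branch' htop s) fun _ h => h.1

theorem lowerBranch_le_upperBranch (htop : Tendsto H atTop atTop) (s : ℝ) :
    lowerBranch H m s ≤ upperBranch H m s :=
  csInf_le_csInf (bddBelow_branch _) (nonempty_branch htop s) fun _ h => ⟨h.1, h.2.le⟩

theorem lowerBranch_le {s q : ℝ} (hq : m ≤ q) (h : s ≤ H q) : lowerBranch H m s ≤ q :=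
  csInf_le (bddBelow_branch _) ⟨hq, h⟩

theorem upperBranch_le {s q : ℝ} (hq : m ≤ q) (h : s < H q) : upperBranch H m s ≤ q :=
  csInf_le (bddBelow_branch _) ⟨hq, h⟩

theorem le_apply_lowerBranch (hH : Continuous H) (htop : Tendsto H atTop atTop) (s : ℝ) :
    s ≤ H (lowerBranch H m s) :=
  ((isClosed_Ici.inter (isClosed_le continuous_const hH)).csInf_mem (nonempty_branch' htop s)
    (bddBelow_branch _)).2

theorem upperBranch_le_lowerBranch (hH : Continuous H) (htop : Tendsto H atTop atTop) {s t : ℝ}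
    (h : s < t) : upperBranch H m s ≤ lowerBranch H m t :=
  upperBranch_le (le_lowerBranch htop t) (h.trans_le (le_apply_lowerBranch hH htop t))

theorem monotone_lowerBranch (htop : Tendsto H atTop atTop) : Monotone (lowerBranch H m) :=
  fun _ t h => csInf_le_csInf (bddBelow_branch _) (nonempty_branch' htop t)
    fun _ hq => ⟨hq.1, h.trans hq.2⟩

theorem monotone_upperBranch (htop : Tendsto H atTop atTop) : Monotone (upperBranch H m) :=
  fun _ t h => csInf_le_csInf (bddBelow_branch _) (nonempty_branch htop t)
    fun _ hq => ⟨hq.1, h.trans_lt hq.2⟩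

theorem apply_le_of_le_upperBranch (hH : Continuous H)
    {s q : ℝ} (hs : H m ≤ s) (hmq : m ≤ q) (hq : q ≤ upperBranch H m s) : H q ≤ s := by
  rcases hmq.eq_or_lt with rfl | hmq
  · exact hs
  by_contra! hlt
  obtain ⟨q', h1, h2⟩ := (((hH.tendsto q).eventually (lt_mem_nhds hlt)).filter_mono
    nhdsWithin_le_nhds |>.and (Ioo_mem_nhdsLT hmq)).exists
  exact absurd (upperBranch_le h2.1.le h1) (not_le.2 (h2.2.trans_le hq))

theorem le_apply_of_lowerBranch_le (hH : Continuous H) (htop : Tendsto H atTop atTop)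
    (hmono : MonotoneOn H (Ici m)) {s q : ℝ} (hq : lowerBranch H m s ≤ q) : s ≤ H q :=
  (le_apply_lowerBranch hH htop s).trans
    (hmono (le_lowerBranch htop s) ((le_lowerBranch htop s).trans hq) hq)

theorem continuousWithinAt_lowerBranch (hH : Continuous H) (htop : Tendsto H atTop atTop)
    (hmono : MonotoneOn H (Ici m)) (s : ℝ) : ContinuousWithinAt (lowerBranch H m) (Iic s) s := by
  refine tendsto_order.2 ⟨fun a ha => ?_, fun a ha => ?_⟩
  · rcases lt_or_ge a m with h | h
    · exact Eventually.of_forall fun t => h.trans_le (le_lowerBranch htop t)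
    · have : H a < s := by
        by_contra! h'
        exact absurd (lowerBranch_le h h') (not_le.2 ha)
      filter_upwards [(lt_mem_nhds this).filter_mono nhdsWithin_le_nhds] with t ht
      by_contra! h'
      exact absurd (le_apply_of_lowerBranch_le hH htop hmono h') (not_le.2 ht)
  · filter_upwards [self_mem_nhdsWithin] with t ht
    exact (monotone_lowerBranch htop ht).trans_lt ha

theorem continuousWithinAt_upperBranch (htop : Tendsto H atTop atTop) (s : ℝ) :
    ContinuousWithinAt (upperBranch H m) (Ici s) s := by
  refine tendsto_order.2 ⟨fun a ha => ?_, fun a ha => ?_⟩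
  · filter_upwards [self_mem_nhdsWithin] with t ht
    exact ha.trans_le (monotone_upperBranch htop ht)
  · obtain ⟨q, hq, hqa⟩ := exists_lt_of_csInf_lt (nonempty_branch htop s) ha
    filter_upwards [(gt_mem_nhds hq.2).filter_mono nhdsWithin_le_nhds] with t ht
    exact (upperBranch_le hq.1 ht).trans_lt hqa

end Branches

/-! ### Averages of monotone functions of the potential -/

section MonotoneComp

variable {K V W : ℝ → ℝ}

theorem Monotone.intervalIntegrable_comp (hK : Monotone K) (hW : Continuous W) (a b : ℝ) :
    IntervalIntegrable (fun x => K (W x)) MeasureTheory.volume a b := by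
  rw [intervalIntegrable_iff]
  obtain ⟨A, hA⟩ := (isCompact_uIcc (a := a) (b := b)).bddBelow_image hW.continuousOn
  obtain ⟨B, hB⟩ := (isCompact_uIcc (a := a) (b := b)).bddAbove_image hW.continuousOn
  refine MeasureTheory.Measure.integrableOn_of_bounded (M := max |K A| |K B|)
    (by simp) (hK.measurable.comp hW.measurable).aestronglyMeasurable ?_
  filter_upwards [MeasureTheory.ae_restrict_mem measurableSet_uIoc] with x hx
  have hx' := uIoc_subset_uIcc hx
  have h1 := hK (hA ⟨x, hx', rfl⟩)
  have h2 := hK (hB ⟨x, hx', rfl⟩)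
  rw [Real.norm_eq_abs]
  exact abs_le_max_abs_abs h1 h2

/-- One-sided continuity passes from `K` to the averages `c ↦ ∫ K (c - V)`. The sides are given by
the translation-covariant family `ι`, meant to be `Iic` or `Ici`. -/
theorem Monotone.continuousWithinAt_integral_sub (hK : Monotone K) (hV : Continuous V) {c : ℝ}
    {ι : ℝ → Set ℝ} (hι : ∀ s t u, t ∈ ι s → t - u ∈ ι (s - u))
    (hcont : ∀ s, ContinuousWithinAt K (ι s) s) :
    ContinuousWithinAt (fun c => ∫ x in (0 : ℝ)..1, K (c - V x)) (ι c) c := by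
  refine intervalIntegral.continuousWithinAt_of_dominated_interval
    (bound := fun x => |K (c - 1 - V x)| + |K (c + 1 - V x)|) ?_ ?_ ?_ ?_
  · exact Eventually.of_forall fun d =>
      (hK.measurable.comp (continuous_const.sub hV).measurable).aestronglyMeasurable
  · filter_upwards [mem_nhdsWithin_of_mem_nhds (Icc_mem_nhds (show c - 1 < c by linarith)
      (show c < c + 1 by linarith))] with d hd
    refine Eventually.of_forall fun x _ => ?_
    have h1 := hK (show c - 1 - V x ≤ d - V x by linarith [hd.1])
    have h2 := hK (show d - V x ≤ c + 1 - V x by linarith [hd.2])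
    rw [Real.norm_eq_abs]
    refine (abs_le_max_abs_abs h1 h2).trans (max_le ?_ ?_) <;> simp
  · exact (hK.intervalIntegrable_comp (continuous_const.sub hV) _ _).abs.add
      (hK.intervalIntegrable_comp (continuous_const.sub hV) _ _).abs
  · refine Eventually.of_forall fun x _ => ?_
    exact ContinuousWithinAt.comp (f := fun d => d - V x) (hcont (c - V x)) (by fun_prop)
      fun d hd => hι c d (V x) hd

end MonotoneComp

/-! ### Levels reached along one branch -/

/-- `c` is a level at which some selection `g ≥ m` of `H (g) = c - V` has mean `p`. It is expressed
through the generalized inverses of `H` on `[m, ∞)`, so that it visibly depends on the distribution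
of `V` only. -/
structure IsRightLevel (H : ℝ → ℝ) (m : ℝ) (V : ℝ → ℝ) (p c : ℝ) : Prop where
  min_add_le : ∀ x, H m + V x ≤ c
  lower_le : ∫ x in (0 : ℝ)..1, lowerBranch H m (c - V x) ≤ p
  le_upper : p ≤ ∫ x in (0 : ℝ)..1, upperBranch H m (c - V x)

section RightLevel

variable {H V : ℝ → ℝ} {m p c : ℝ}

/-- The level is the largest `c` with `∫ lowerBranch (c - V) ≤ p`; one-sided continuity of the two
averages makes it lie in the closed window that defines `IsRightLevel`. -/
theorem exists_isRightLevel (hH : Continuous H) (htop : Tendsto H atTop atTop)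
    (hmono : MonotoneOn H (Ici m)) (hV : Continuous V) (hper : Function.Periodic V 1) {c₀ : ℝ}
    (h₀ : ∀ x, H m + V x ≤ c₀) (hp : ∫ x in (0 : ℝ)..1, lowerBranch H m (c₀ - V x) ≤ p) :
    ∃ c, IsRightLevel H m V p c := by
  have hlo := monotone_lowerBranch (m := m) htop
  have hup := monotone_upperBranch (m := m) htop
  set F : ℝ → ℝ := fun c => ∫ x in (0 : ℝ)..1, lowerBranch H m (c - V x) with hF
  set S := {c | c₀ ≤ c ∧ F c ≤ p} with hS
  have hSne : S.Nonempty := ⟨c₀, le_rfl, hp⟩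
  obtain ⟨x₀, hx₀⟩ := hper.exists_forall_le_of_continuous hV
  have hSbdd : BddAbove S := by
    refine ⟨H (max m (p + 1)) + 1 + V x₀, fun c hc => ?_⟩
    by_contra! hlt
    have h1 : p + 1 ≤ F c := by
      have := intervalIntegral.integral_mono_on (μ := MeasureTheory.volume) (zero_le_one (α := ℝ))
        (intervalIntegrable_const (c := p + 1))
        (hlo.intervalIntegrable_comp (continuous_const (y := c) |>.sub hV) 0 1) fun x _ => ?_
      · simpa using this
      · by_contra! h
        have h2 := le_apply_of_lowerBranch_le hH htop hmono (h.le.trans (le_max_right m (p + 1)))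
        simp only [Pi.sub_apply] at h2
        linarith [hx₀ x]
    linarith [hc.2]
  have hc₀ : c₀ ≤ sSup S := le_csSup hSbdd ⟨le_rfl, hp⟩
  refine ⟨sSup S, fun x => (h₀ x).trans hc₀, ?_, ?_⟩
  · have hcont : ContinuousWithinAt F (Iic (sSup S)) (sSup S) :=
      hlo.continuousWithinAt_integral_sub hV (ι := Iic) (fun s t u h => sub_le_sub_right h u)
        (continuousWithinAt_lowerBranch hH htop hmono)
    have hmem : sSup S ∈ closure S := csSup_mem_closure hSne hSbdd
    have := (hcont.mono (fun c hc => le_csSup hSbdd hc : S ⊆ Iic (sSup S))).mem_closure_image hmem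
    exact closure_minimal (by rintro _ ⟨c, hc, rfl⟩; exact hc.2) isClosed_Iic this
  · have hcont := (hup.continuousWithinAt_integral_sub hV (c := sSup S) (ι := Ici)
      (fun s t u h => sub_le_sub_right h u) (continuousWithinAt_upperBranch htop)).mono
      Ioi_subset_Ici_self
    refine ge_of_tendsto (x := 𝓝[>] (sSup S)) hcont ?_
    filter_upwards [self_mem_nhdsWithin] with d hd
    have h1 : p < F d := by
      by_contra! h
      exact absurd (le_csSup hSbdd ⟨hc₀.trans (le_of_lt hd), h⟩) (not_le.2 hd)
    exact h1.le.trans (intervalIntegral.integral_mono zero_le_one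
      (hlo.intervalIntegrable_comp (continuous_const.sub hV) _ _)
      (hup.intervalIntegrable_comp (continuous_const.sub hV) _ _)
      fun x => lowerBranch_le_upperBranch htop _)

theorem exists_convexCombination_integral_eq {g₀ g₁ : ℝ → ℝ}
    (h₀ : ∀ a b, IntervalIntegrable g₀ MeasureTheory.volume a b)
    (h₁ : ∀ a b, IntervalIntegrable g₁ MeasureTheory.volume a b)
    (hp₀ : ∫ x in (0 : ℝ)..1, g₀ x ≤ p) (hp₁ : p ≤ ∫ x in (0 : ℝ)..1, g₁ x) :
    ∃ θ ∈ Icc (0 : ℝ) 1, ∫ x in (0 : ℝ)..1, ((1 - θ) * g₀ x + θ * g₁ x) = p := by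
  set a := ∫ x in (0 : ℝ)..1, g₀ x
  set b := ∫ x in (0 : ℝ)..1, g₁ x
  have hcont : ContinuousOn (fun θ : ℝ => (1 - θ) * a + θ * b) (Icc 0 1) := by fun_prop
  obtain ⟨θ, hθ, h⟩ := intermediate_value_Icc zero_le_one hcont
    (show p ∈ Icc _ _ from ⟨by simpa using hp₀, by simpa using hp₁⟩)
  refine ⟨θ, hθ, ?_⟩
  rw [intervalIntegral.integral_add ((h₀ _ _).const_mul _) ((h₁ _ _).const_mul _),
    intervalIntegral.integral_const_mul, intervalIntegral.integral_const_mul]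
  exact h

theorem le_convexCombination {a b q θ : ℝ} (hθ : θ ∈ Icc (0 : ℝ) 1) (ha : q ≤ a) (hb : q ≤ b) :
    q ≤ (1 - θ) * a + θ * b := by
  nlinarith [hθ.1, hθ.2]

theorem convexCombination_le {a b q θ : ℝ} (hθ : θ ∈ Icc (0 : ℝ) 1) (ha : a ≤ q) (hb : b ≤ q) :
    (1 - θ) * a + θ * b ≤ q := by
  nlinarith [hθ.1, hθ.2]

theorem IsRightLevel.exists_selection (h : IsRightLevel H m V p c) (hH : Continuous H)
    (htop : Tendsto H atTop atTop) (hmono : MonotoneOn H (Ici m)) (hV : Continuous V)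
    (hper : Function.Periodic V 1) :
    ∃ g : ℝ → ℝ, (∀ a b, IntervalIntegrable g MeasureTheory.volume a b) ∧ Function.Periodic g 1 ∧
      ∫ x in (0 : ℝ)..1, g x = p ∧ ∀ x, m ≤ g x ∧ H (g x) + V x = c := by
  have hlo := (monotone_lowerBranch (m := m) htop).intervalIntegrable_comp
    (continuous_const (y := c) |>.sub hV)
  have hup := (monotone_upperBranch (m := m) htop).intervalIntegrable_comp
    (continuous_const (y := c) |>.sub hV)
  obtain ⟨θ, hθ, hint⟩ := exists_convexCombination_integral_eq hlo hup h.lower_le h.le_upper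
  refine ⟨_, fun a b => ((hlo a b).const_mul _).add ((hup a b).const_mul _),
    fun x => by simp [hper x], hint, fun x => ?_⟩
  have hle := lowerBranch_le_upperBranch (m := m) htop (c - V x)
  have h1 := le_convexCombination hθ le_rfl hle
  have h2 := convexCombination_le hθ hle le_rfl
  have hm := (le_lowerBranch htop _).trans h1
  refine ⟨hm, ?_⟩
  have h3 := apply_le_of_le_upperBranch hH (by linarith [h.min_add_le x]) hm h2
  have h4 := le_apply_of_lowerBranch_le hH htop hmono h1
  simp only [Pi.sub_apply] at h3 h4 ⊢
  linarith

/-- The upper branch averaged over `[s, s + ε]`: continuous in `s`. -/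
noncomputable def averagedBranch (H : ℝ → ℝ) (m ε s : ℝ) : ℝ :=
  ε⁻¹ * ∫ t in s..s + ε, upperBranch H m t

theorem continuous_averagedBranch (htop : Tendsto H atTop atTop) (ε : ℝ) :
    Continuous (averagedBranch H m ε) := by
  have hi : ∀ a b, IntervalIntegrable (upperBranch H m) MeasureTheory.volume a b :=
    fun a b => (monotone_upperBranch htop).intervalIntegrable
  have hc := intervalIntegral.continuous_primitive hi 0
  have : averagedBranch H m ε = fun s => ε⁻¹ * ((∫ t in (0 : ℝ)..s + ε, upperBranch H m t) -
      ∫ t in (0 : ℝ)..s, upperBranch H m t) := by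
    funext s
    rw [intervalIntegral.integral_interval_sub_left (hi _ _) (hi _ _)]
    rfl
  rw [this]
  fun_prop

theorem upperBranch_le_averagedBranch (htop : Tendsto H atTop atTop) {ε : ℝ} (hε : 0 < ε) (s : ℝ) :
    upperBranch H m s ≤ averagedBranch H m ε s := by
  have := intervalIntegral.integral_mono_on (show s ≤ s + ε by linarith)
    (intervalIntegrable_const (c := upperBranch H m s))
    ((monotone_upperBranch (m := m) htop).intervalIntegrable (μ := MeasureTheory.volume))
    fun t ht => monotone_upperBranch htop ht.1
  rw [intervalIntegral.integral_const, smul_eq_mul, add_sub_cancel_left] at this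
  rw [averagedBranch, le_inv_mul_iff₀ hε]
  exact this

theorem averagedBranch_le_upperBranch (htop : Tendsto H atTop atTop) {ε : ℝ} (hε : 0 < ε) (s : ℝ) :
    averagedBranch H m ε s ≤ upperBranch H m (s + ε) := by
  have := intervalIntegral.integral_mono_on (show s ≤ s + ε by linarith)
    ((monotone_upperBranch (m := m) htop).intervalIntegrable (μ := MeasureTheory.volume))
    (intervalIntegrable_const (c := upperBranch H m (s + ε)))
    fun t ht => monotone_upperBranch htop ht.2
  rw [intervalIntegral.integral_const, smul_eq_mul, add_sub_cancel_left] at this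
  rw [averagedBranch, inv_mul_le_iff₀ hε]
  exact this

theorem averagedBranch_le_lowerBranch (hH : Continuous H) (htop : Tendsto H atTop atTop)
    {ε : ℝ} (hε : 0 < ε) (s : ℝ) : averagedBranch H m ε s ≤ lowerBranch H m (s + ε) := by
  have := intervalIntegral.integral_mono_on_of_le_Ioo (show s ≤ s + ε by linarith)
    ((monotone_upperBranch (m := m) htop).intervalIntegrable (μ := MeasureTheory.volume))
    (intervalIntegrable_const (c := lowerBranch H m (s + ε)))
    fun t ht => upperBranch_le_lowerBranch hH htop ht.2
  rw [intervalIntegral.integral_const, smul_eq_mul, add_sub_cancel_left] at this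
  rw [averagedBranch, inv_mul_le_iff₀ hε]
  exact this

/-- Continuous approximate solutions of `H (g) + V = c` with mean `p`. They serve as `C¹` test
functions against an arbitrary solution of the cell problem. -/
theorem IsRightLevel.exists_continuous (h : IsRightLevel H m V p c) (hH : Continuous H)
    (htop : Tendsto H atTop atTop) (hmono : MonotoneOn H (Ici m)) (hV : Continuous V)
    (hper : Function.Periodic V 1) {ε : ℝ} (hε : 0 < ε) :
    ∃ g : ℝ → ℝ, Continuous g ∧ Function.Periodic g 1 ∧ ∫ x in (0 : ℝ)..1, g x = p ∧
      ∀ x, c - ε ≤ H (g x) + V x ∧ H (g x) + V x ≤ c + ε := by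
  set A := averagedBranch H m ε with hA
  have hAc : Continuous A := continuous_averagedBranch htop ε
  have hg₀ : Continuous fun x => A (c - ε - V x) := by fun_prop
  have hg₁ : Continuous fun x => A (c - V x) := by fun_prop
  have hle₀ : ∀ x, A (c - ε - V x) ≤ lowerBranch H m (c - V x) := fun x => by
    have := averagedBranch_le_lowerBranch (m := m) hH htop hε (c - ε - V x)
    rwa [show c - ε - V x + ε = c - V x by ring] at this
  have hle₁ : ∀ x, upperBranch H m (c - V x) ≤ A (c - V x) := fun x =>
    upperBranch_le_averagedBranch htop hε _
  have hlo := (monotone_lowerBranch (m := m) htop).intervalIntegrable_comp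
    (continuous_const (y := c) |>.sub hV)
  have hup := (monotone_upperBranch (m := m) htop).intervalIntegrable_comp
    (continuous_const (y := c) |>.sub hV)
  obtain ⟨θ, hθ, hint⟩ := exists_convexCombination_integral_eq (p := p)
    (g₀ := fun x => A (c - ε - V x)) (g₁ := fun x => A (c - V x))
    hg₀.intervalIntegrable hg₁.intervalIntegrable
    ((intervalIntegral.integral_mono zero_le_one (hg₀.intervalIntegrable _ _) (hlo 0 1)
      hle₀).trans h.lower_le)
    (h.le_upper.trans (intervalIntegral.integral_mono zero_le_one (hup 0 1)
      (hg₁.intervalIntegrable _ _) hle₁))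
  refine ⟨_, by fun_prop, fun x => by simp [hper x], hint, fun x => ?_⟩
  have hle : A (c - ε - V x) ≤ A (c - V x) :=
    (hle₀ x).trans ((lowerBranch_le_upperBranch htop _).trans (hle₁ x))
  have h1 := (upperBranch_le_averagedBranch htop hε (c - ε - V x)).trans
    (le_convexCombination hθ le_rfl hle)
  have h2 := (convexCombination_le hθ hle le_rfl).trans
    (averagedBranch_le_upperBranch htop hε (c - V x))
  have h3 := (lowerBranch_le_upperBranch htop _).trans h1
  have h4 := apply_le_of_le_upperBranch hH (by linarith [h.min_add_le x])
    ((le_lowerBranch htop _).trans h3) h2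
  have h5 := le_apply_of_lowerBranch_le hH htop hmono h3
  constructor <;> linarith

end RightLevel

/-! ### The flat part and the effective Hamiltonian -/

/-- The level attained by a mean momentum `p` that lies between the two branches of `H` over the
maximal potential: the flat part of the effective Hamiltonian. The decreasing branch of `H` is
expressed through the increasing branch of `q ↦ H (-q)`. -/
structure IsFlatLevel (H : ℝ → ℝ) (m : ℝ) (V : ℝ → ℝ) (p c : ℝ) : Prop where
  min_add_le : ∀ x, H m + V x ≤ c
  exists_eq : ∃ x, H m + V x = c
  left_le : -∫ x in (0 : ℝ)..1, lowerBranch (fun q => H (-q)) (-m) (c - V x) ≤ p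
  le_right : p ≤ ∫ x in (0 : ℝ)..1, lowerBranch H m (c - V x)

/-- Following `g₀` from `x₀` to `x₀ + t` and `g₁` on the rest of the period, one reaches every mean
between those of `g₁` and `g₀`. -/
theorem exists_switch_integral_eq {g₀ g₁ : ℝ → ℝ} {p : ℝ} (x₀ : ℝ)
    (h₀ : ∀ a b, IntervalIntegrable g₀ MeasureTheory.volume a b) (hper₀ : Function.Periodic g₀ 1)
    (h₁ : ∀ a b, IntervalIntegrable g₁ MeasureTheory.volume a b) (hper₁ : Function.Periodic g₁ 1)
    (hp₁ : ∫ x in (0 : ℝ)..1, g₁ x ≤ p) (hp₀ : p ≤ ∫ x in (0 : ℝ)..1, g₀ x) :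
    ∃ t : ℝ, (∀ a b, IntervalIntegrable
        (fun x => if Int.fract (x - x₀) < t then g₀ x else g₁ x) MeasureTheory.volume a b) ∧
      ∫ x in (0 : ℝ)..1, (if Int.fract (x - x₀) < t then g₀ x else g₁ x) = p := by
  have hc₀ := intervalIntegral.continuous_primitive h₀ x₀
  have hc₁ := intervalIntegral.continuous_primitive h₁ (x₀ + 1)
  have hcont : Continuous fun t : ℝ =>
      (∫ x in x₀..x₀ + t, g₀ x) - ∫ x in (x₀ + 1)..(x₀ + t), g₁ x := by fun_prop
  obtain ⟨t, ht, htp⟩ := intermediate_value_Icc zero_le_one hcont.continuousOn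
    (show p ∈ Icc _ _ from ⟨by
      rw [add_zero, intervalIntegral.integral_same, intervalIntegral.integral_symm,
        hper₁.intervalIntegral_add_eq x₀ 0, zero_add]
      linarith, by
      rw [intervalIntegral.integral_same, hper₀.intervalIntegral_add_eq x₀ 0, zero_add]
      linarith⟩)
  have hint : ∀ a b, IntervalIntegrable
      (fun x => if Int.fract (x - x₀) < t then g₀ x else g₁ x) MeasureTheory.volume a b := by
    intro a b
    rw [intervalIntegrable_iff]
    have hmeas : MeasurableSet {x : ℝ | Int.fract (x - x₀) < t} :=
      measurableSet_lt (measurable_fract.comp (measurable_id.sub_const x₀)) measurable_const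
    classical
    refine (MeasureTheory.Integrable.piecewise hmeas
      (intervalIntegrable_iff.1 (h₀ a b)).integrableOn
      (intervalIntegrable_iff.1 (h₁ a b)).integrableOn).congr (Eventually.of_forall fun x => ?_)
    by_cases h : Int.fract (x - x₀) < t <;> simp [h]
  have hper : Function.Periodic (fun x => if Int.fract (x - x₀) < t then g₀ x else g₁ x) 1 := by
    intro x
    simp only [hper₀ x, hper₁ x, add_sub_right_comm, Int.fract_add_one]
  refine ⟨t, hint, ?_⟩
  have hshift := hper.intervalIntegral_add_eq 0 x₀
  rw [zero_add] at hshift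
  rw [hshift, ← intervalIntegral.integral_add_adjacent_intervals (hint x₀ (x₀ + t)) (hint _ _),
    ← htp]
  simp only [sub_eq_add_neg (∫ x in x₀..x₀ + t, g₀ x), ← intervalIntegral.integral_symm]
  have hfract : ∀ x, x₀ < x → x < x₀ + 1 → Int.fract (x - x₀) = x - x₀ := fun x h1 h2 =>
    Int.fract_eq_self.2 ⟨by linarith, by linarith⟩
  congr 1
  · refine intervalIntegral.integral_congr_uIoo fun x hx => ?_
    rw [uIoo_of_le (by linarith [ht.1])] at hx
    have : Int.fract (x - x₀) < t := by
      rw [hfract x hx.1 (by linarith [hx.2, ht.2])]; linarith [hx.2]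
    simp [this]
  · refine intervalIntegral.integral_congr_uIoo fun x hx => ?_
    rw [uIoo_of_le (by linarith [ht.2])] at hx
    have : ¬ Int.fract (x - x₀) < t := by
      rw [hfract x (by linarith [hx.1, ht.1]) hx.2]; linarith [hx.1]
    simp [this]

theorem eventually_left_fract_lt {x x₀ t : ℝ} (h0 : 0 < Int.fract (x - x₀))
    (ht : Int.fract (x - x₀) ≤ t) : ∀ᶠ y in 𝓝[<] x, Int.fract (y - x₀) < t := by
  filter_upwards [Ioo_mem_nhdsLT (show x - Int.fract (x - x₀) < x by linarith)] with y hy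
  have : Int.fract (y - x₀) = Int.fract (x - x₀) + (y - x) := by
    refine Int.fract_eq_iff.2 ⟨by linarith [hy.1], ?_, ⌊x - x₀⌋, ?_⟩
    · linarith [hy.2, Int.fract_lt_one (x - x₀)]
    · rw [Int.fract]; ring
  linarith [hy.2]

theorem eventually_right_le_fract {x x₀ t : ℝ} (ht : t ≤ Int.fract (x - x₀)) :
    ∀ᶠ y in 𝓝[>] x, t ≤ Int.fract (y - x₀) := by
  have h1 := Int.fract_lt_one (x - x₀)
  have h0 := Int.fract_nonneg (x - x₀)
  filter_upwards [Ioo_mem_nhdsGT (show x < x + (1 - Int.fract (x - x₀)) by linarith)] with y hy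
  have : Int.fract (y - x₀) = Int.fract (x - x₀) + (y - x) := by
    refine Int.fract_eq_iff.2 ⟨by linarith [hy.1], by linarith [hy.2], ⌊x - x₀⌋, ?_⟩
    rw [Int.fract]; ring
  linarith [hy.1]

section EffectiveHamiltonian

variable {H V : ℝ → ℝ} {m p c : ℝ}

theorem effectiveHamiltonian_eq_of_selection (hH : Continuous H) (hV : Continuous V)
    (hanti : AntitoneOn H (Iic m)) (hmono : MonotoneOn H (Ici m)) {g : ℝ → ℝ}
    (hg : ∀ a b, IntervalIntegrable g MeasureTheory.volume a b)
    (hper : Function.Periodic g 1) (hp : ∫ x in (0 : ℝ)..1, g x = p)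
    (hside : (∀ x, m ≤ g x) ∨ ∀ x, g x ≤ m) (hc : ∀ x, H (g x) + V x = c)
    (happrox : ∀ ε > 0, ∃ g : ℝ → ℝ, Continuous g ∧ Function.Periodic g 1 ∧
      ∫ x in (0 : ℝ)..1, g x = p ∧ ∀ x, c - ε ≤ H (g x) + V x ∧ H (g x) + V x ≤ c + ε) :
    effectiveHamiltonian H V p = c := by
  refine effectiveHamiltonian_eq (isCellSolution_corrector hH hV hanti hmono hg hper hp
    (fun x => (hc x).le) fun x => Or.inr ?_) fun c' v hv => le_antisymm ?_ ?_
  · rcases hside with h | h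
    · exact Or.inl (Eventually.of_forall fun y => ⟨h y, (hc y).ge⟩)
    · exact Or.inr (Eventually.of_forall fun y => ⟨h y, (hc y).ge⟩)
  · refine le_of_forall_pos_le_add fun ε hε => ?_
    obtain ⟨g, h1, h2, h3, h4⟩ := happrox ε hε
    exact hv.le_of_forall_le h1 h2 h3 fun x => (h4 x).2
  · refine le_of_forall_pos_le_add fun ε hε => ?_
    obtain ⟨g, h1, h2, h3, h4⟩ := happrox ε hε
    linarith [hv.ge_of_forall_ge h1 h2 h3 fun x => (h4 x).1]

theorem AntitoneOn.monotoneOn_comp_neg (hanti : AntitoneOn H (Iic m)) :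
    MonotoneOn (fun q => H (-q)) (Ici (-m)) := fun a ha b hb hab =>
  hanti (by simpa using neg_le.1 hb) (by simpa using neg_le.1 ha) (neg_le_neg hab)

theorem Coercive.tendsto_atTop (h : Coercive H) : Tendsto H atTop atTop :=
  h.mono_left atTop_le_cocompact

theorem Coercive.tendsto_comp_neg (h : Coercive H) : Tendsto (fun q => H (-q)) atTop atTop :=
  (h.mono_left atBot_le_cocompact).comp tendsto_neg_atTop_atBot

theorem IsRightLevel.effectiveHamiltonian_eq (h : IsRightLevel H m V p c) (hH : Continuous H)
    (hcoer : Coercive H) (hanti : AntitoneOn H (Iic m)) (hmono : MonotoneOn H (Ici m))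
    (hV : Continuous V) (hper : Function.Periodic V 1) : effectiveHamiltonian H V p = c := by
  obtain ⟨g, h1, h2, h3, h4⟩ := h.exists_selection hH hcoer.tendsto_atTop hmono hV hper
  exact effectiveHamiltonian_eq_of_selection hH hV hanti hmono h1 h2 h3
    (Or.inl fun x => (h4 x).1) (fun x => (h4 x).2)
    fun ε hε => h.exists_continuous hH hcoer.tendsto_atTop hmono hV hper hε

theorem effectiveHamiltonian_eq_of_isRightLevel_neg
    (h : IsRightLevel (fun q => H (-q)) (-m) V (-p) c) (hH : Continuous H)
    (hcoer : Coercive H) (hanti : AntitoneOn H (Iic m)) (hmono : MonotoneOn H (Ici m))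
    (hV : Continuous V) (hper : Function.Periodic V 1) : effectiveHamiltonian H V p = c := by
  have hH' : Continuous fun q => H (-q) := hH.comp continuous_neg
  obtain ⟨g, h1, h2, h3, h4⟩ := h.exists_selection hH' hcoer.tendsto_comp_neg
    hanti.monotoneOn_comp_neg hV hper
  refine effectiveHamiltonian_eq_of_selection (g := fun x => -g x) hH hV hanti hmono
    (fun a b => (h1 a b).neg) (fun x => by simp [h2 x])
    (by rw [intervalIntegral.integral_neg, h3, neg_neg])
    (Or.inr fun x => neg_le.1 (h4 x).1) (fun x => (h4 x).2) fun ε hε => ?_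
  obtain ⟨g, h1, h2, h3, h4⟩ := h.exists_continuous hH' hcoer.tendsto_comp_neg
    hanti.monotoneOn_comp_neg hV hper hε
  exact ⟨fun x => -g x, h1.neg, fun x => by simp [h2 x],
    by rw [intervalIntegral.integral_neg, h3, neg_neg], h4⟩

theorem apply_lowerBranch (hH : Continuous H) (htop : Tendsto H atTop atTop) {s : ℝ}
    (hs : H m ≤ s) : H (lowerBranch H m s) = s :=
  le_antisymm (apply_le_of_le_upperBranch hH hs (le_lowerBranch htop s)
    (lowerBranch_le_upperBranch htop s)) (le_apply_lowerBranch hH htop s)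

/-- On the flat part a solution follows the increasing branch from a maximum point `x₀` of `V` up to
a switching point and the decreasing branch from there to `x₀ + 1`. The kink at the switching point
is concave; at `x₀` the supersolution inequality holds for every slope. -/
theorem IsFlatLevel.exists_isCellSolution (h : IsFlatLevel H m V p c) (hH : Continuous H)
    (hcoer : Coercive H) (hanti : AntitoneOn H (Iic m)) (hmono : MonotoneOn H (Ici m))
    (hV : Continuous V) (hper : Function.Periodic V 1) : ∃ v, IsCellSolution H V p c v := by
  have htop := hcoer.tendsto_atTop
  have htop' := hcoer.tendsto_comp_neg
  obtain ⟨x₀, hx₀⟩ := h.exists_eq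
  set g₀ : ℝ → ℝ := fun x => lowerBranch H m (c - V x) with hg₀
  set g₁ : ℝ → ℝ := fun x => -lowerBranch (fun q => H (-q)) (-m) (c - V x) with hg₁
  have h₀ : ∀ a b, IntervalIntegrable g₀ MeasureTheory.volume a b :=
    (monotone_lowerBranch htop).intervalIntegrable_comp (continuous_const.sub hV)
  have h₁ : ∀ a b, IntervalIntegrable g₁ MeasureTheory.volume a b := fun a b =>
    ((monotone_lowerBranch htop').intervalIntegrable_comp (continuous_const.sub hV) a b).neg
  have hper₀ : Function.Periodic g₀ 1 := fun x => by simp [hg₀, hper x]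
  have hper₁ : Function.Periodic g₁ 1 := fun x => by simp [hg₁, hper x]
  have hm₀ : ∀ x, m ≤ g₀ x := fun x => le_lowerBranch htop _
  have hm₁ : ∀ x, g₁ x ≤ m := fun x => neg_le.1 (le_lowerBranch htop' _)
  have hc₀ : ∀ x, H (g₀ x) + V x = c := fun x => by
    have := apply_lowerBranch (m := m) hH htop (s := c - V x) (by linarith [h.min_add_le x])
    simp only [hg₀]; linarith
  have hc₁ : ∀ x, H (g₁ x) + V x = c := fun x => by
    have := apply_lowerBranch (m := -m) (hH.comp continuous_neg) htop' (s := c - V x)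
      (by simp only [Function.comp, neg_neg]; linarith [h.min_add_le x])
    simp only [hg₁]; simp only [Function.comp_def] at this; linarith
  obtain ⟨t, hint, hp⟩ := exists_switch_integral_eq (p := p) x₀ h₀ hper₀ h₁ hper₁
    (by rw [hg₁, intervalIntegral.integral_neg]; exact h.left_le) h.le_right
  refine ⟨_, isCellSolution_corrector hH hV hanti hmono hint (fun x => ?_) hp (fun x => ?_)
    fun x => ?_⟩
  · simp only [hper₀ x, hper₁ x, add_sub_right_comm, Int.fract_add_one]
  · split_ifs
    exacts [(hc₀ x).le, (hc₁ x).le]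
  · rcases (Int.fract_nonneg (x - x₀)).eq_or_lt with h0 | h0
    · left
      obtain ⟨n, hn⟩ := Int.fract_eq_zero_iff.1 h0.symm
      have : V x = V x₀ := by
        have := hper.int_mul n x₀
        rw [mul_one] at this
        rw [← this, hn]; congr 1; ring
      rw [this, hx₀]
    right
    rcases le_total (Int.fract (x - x₀)) t with h1 | h1
    · left
      filter_upwards [eventually_left_fract_lt h0 h1] with y hy
      rw [if_pos hy]
      exact ⟨hm₀ y, (hc₀ y).ge⟩
    · right
      filter_upwards [eventually_right_le_fract h1] with y hy
      rw [if_neg (not_lt.2 hy)]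
      exact ⟨hm₁ y, (hc₁ y).ge⟩

/-- The bound `c' ≤ c` uses a continuous approximate subsolution that interpolates between approximations
of the two branches, where quasi-convexity of `H` keeps it admissible; the bound `c ≤ c'` is the
general lower bound at a maximum point of `V`. -/
theorem IsFlatLevel.effectiveHamiltonian_eq (h : IsFlatLevel H m V p c) (hH : Continuous H)
    (hcoer : Coercive H) (hanti : AntitoneOn H (Iic m)) (hmono : MonotoneOn H (Ici m))
    (hV : Continuous V) (hper : Function.Periodic V 1) : effectiveHamiltonian H V p = c := by
  have htop := hcoer.tendsto_atTop
  have htop' := hcoer.tendsto_comp_neg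
  have hH' : Continuous fun q => H (-q) := hH.comp continuous_neg
  have hmin : ∀ q, H m ≤ H q := fun q => (le_total m q).elim
    (fun h => hmono self_mem_Ici h h) (fun h => hanti h self_mem_Iic h)
  obtain ⟨v, hv⟩ := h.exists_isCellSolution hH hcoer hanti hmono hV hper
  refine _root_.effectiveHamiltonian_eq hv fun c' w hw => le_antisymm ?_ ?_
  swap
  · obtain ⟨x₀, hx₀⟩ := h.exists_eq
    exact hx₀ ▸ hw.min_add_le hV hmin x₀
  refine le_of_forall_pos_le_add fun ε hε => ?_
  have hA := continuous_averagedBranch (m := m) htop ε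
  have hA' := continuous_averagedBranch (m := -m) htop' ε
  have hlow := fun s => (lowerBranch_le_upperBranch (m := m) htop s).trans
    (upperBranch_le_averagedBranch htop hε s)
  have hlow' := fun s => (lowerBranch_le_upperBranch (m := -m) htop' s).trans
    (upperBranch_le_averagedBranch htop' hε s)
  have hA₀ : Continuous fun x => averagedBranch H m ε (c - V x) := by fun_prop
  have hA₁ : Continuous fun x => -averagedBranch (fun q => H (-q)) (-m) ε (c - V x) := by fun_prop
  obtain ⟨θ, hθ, hp⟩ := exists_convexCombination_integral_eq (p := p)
    hA₁.intervalIntegrable hA₀.intervalIntegrable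
    (le_trans (by
      rw [← intervalIntegral.integral_neg]
      exact intervalIntegral.integral_mono zero_le_one (hA₁.intervalIntegrable _ _)
        ((monotone_lowerBranch htop').intervalIntegrable_comp
          (continuous_const.sub hV) _ _).neg fun x => neg_le_neg (hlow' _)) h.left_le)
    (h.le_right.trans (intervalIntegral.integral_mono zero_le_one
      ((monotone_lowerBranch htop).intervalIntegrable_comp (continuous_const.sub hV) _ _)
      (hA₀.intervalIntegrable _ _) fun x => hlow _))
  refine hw.le_of_forall_le (by fun_prop) (fun x => by simp only [hper x]) hp fun x => ?_
  set a := -averagedBranch (fun q => H (-q)) (-m) ε (c - V x) with ha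
  set b := averagedBranch H m ε (c - V x) with hb
  have hmb : m ≤ b := (le_lowerBranch htop _).trans (hlow _)
  have hma' : -m ≤ averagedBranch (fun q => H (-q)) (-m) ε (c - V x) :=
    (le_lowerBranch htop' _).trans (hlow' _)
  have hma : a ≤ m := neg_le.1 hma'
  have hs : H m ≤ c - V x + ε := by linarith [h.min_add_le x]
  have hHb : H b ≤ c - V x + ε := apply_le_of_le_upperBranch hH hs hmb
    (averagedBranch_le_upperBranch htop hε _)
  have hHa : H a ≤ c - V x + ε := apply_le_of_le_upperBranch hH' (by simpa using hs) hma'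
    (averagedBranch_le_upperBranch htop' hε _)
  have h1 := le_convexCombination hθ le_rfl (hma.trans hmb)
  have h2 := convexCombination_le hθ (hma.trans hmb) le_rfl
  rcases le_total m ((1 - θ) * a + θ * b) with h3 | h3
  · linarith [hmono h3 hmb h2]
  · linarith [hanti hma h3 h1]

/-! ### Dependence on the distribution of the potential -/

theorem SameDistribution.integral_comp_eq {V₁ V₂ : ℝ → ℝ} (h : SameDistribution V₁ V₂)
    (hV₁ : Continuous V₁) (hV₂ : Continuous V₂) {f : ℝ → ℝ} (hf : Measurable f) :
    ∫ x in (0 : ℝ)..1, f (V₁ x) = ∫ x in (0 : ℝ)..1, f (V₂ x) := by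
  set μ := MeasureTheory.volume.restrict (Ioc (0 : ℝ) 1)
  have hmap : μ.map V₁ = μ.map V₂ := by
    have := MeasureTheory.Measure.isFiniteMeasure_map μ V₁
    have := MeasureTheory.Measure.isFiniteMeasure_map μ V₂
    refine MeasureTheory.ext_of_forall_integral_eq_of_IsFiniteMeasure fun f => ?_
    rw [MeasureTheory.integral_map hV₁.aemeasurable f.continuous.aestronglyMeasurable,
      MeasureTheory.integral_map hV₂.aemeasurable f.continuous.aestronglyMeasurable,
      ← intervalIntegral.integral_of_le zero_le_one, ← intervalIntegral.integral_of_le zero_le_one]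
    exact h f f.continuous
  rw [intervalIntegral.integral_of_le zero_le_one, intervalIntegral.integral_of_le zero_le_one,
    ← MeasureTheory.integral_map hV₁.aemeasurable hf.aestronglyMeasurable, hmap,
    MeasureTheory.integral_map hV₂.aemeasurable hf.aestronglyMeasurable]

theorem SameDistribution.forall_le {V₁ V₂ : ℝ → ℝ} (h : SameDistribution V₁ V₂)
    (hV₂ : Continuous V₂) (hper₂ : Function.Periodic V₂ 1) {C : ℝ}
    (h₁ : ∀ x, V₁ x ≤ C) (x : ℝ) : V₂ x ≤ C := by
  by_contra! hlt
  obtain ⟨y, hy, hxy⟩ := hper₂.exists_mem_Ico₀ one_pos x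
  have h0 : ∫ x in (0 : ℝ)..1, max (V₁ x - C) 0 = 0 := by
    simp [max_eq_right (sub_nonpos.2 (h₁ _))]
  have h1 : 0 < ∫ x in (0 : ℝ)..1, max (V₂ x - C) 0 :=
    intervalIntegral.integral_pos one_pos (by fun_prop) (fun _ _ => le_max_right _ _)
      ⟨y, Ico_subset_Icc_self hy, lt_max_of_lt_left (by rw [← hxy]; linarith)⟩
  have := h (fun s => max (s - C) 0) (by fun_prop)
  linarith

theorem SameDistribution.symm {V₁ V₂ : ℝ → ℝ} (h : SameDistribution V₁ V₂) :
    SameDistribution V₂ V₁ := fun f hf => (h f hf).symm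

theorem SameDistribution.integral_sub_eq {V₁ V₂ : ℝ → ℝ} (h : SameDistribution V₁ V₂)
    (hV₁ : Continuous V₁) (hV₂ : Continuous V₂) {K : ℝ → ℝ} (hK : Monotone K) (c : ℝ) :
    ∫ x in (0 : ℝ)..1, K (c - V₁ x) = ∫ x in (0 : ℝ)..1, K (c - V₂ x) :=
  h.integral_comp_eq hV₁ hV₂ (hK.measurable.comp (measurable_const.sub measurable_id))

theorem IsRightLevel.congr_distribution {V₁ V₂ : ℝ → ℝ} (hl : IsRightLevel H m V₁ p c)
    (htop : Tendsto H atTop atTop) (h : SameDistribution V₁ V₂) (hV₁ : Continuous V₁)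
    (hV₂ : Continuous V₂) (hper₂ : Function.Periodic V₂ 1) : IsRightLevel H m V₂ p c where
  min_add_le x := by
    linarith [h.forall_le hV₂ hper₂ (C := c - H m) (fun x => by linarith [hl.min_add_le x]) x]
  lower_le := by
    rw [← h.integral_sub_eq hV₁ hV₂ (monotone_lowerBranch htop)]
    exact hl.lower_le
  le_upper := by
    rw [← h.integral_sub_eq hV₁ hV₂ (monotone_upperBranch htop)]
    exact hl.le_upper

theorem IsFlatLevel.congr_distribution {V₁ V₂ : ℝ → ℝ} (hl : IsFlatLevel H m V₁ p c)
    (hcoer : Coercive H) (h : SameDistribution V₁ V₂) (hV₁ : Continuous V₁)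
    (hper₁ : Function.Periodic V₁ 1)
    (hV₂ : Continuous V₂) (hper₂ : Function.Periodic V₂ 1) : IsFlatLevel H m V₂ p c where
  min_add_le x := by
    linarith [h.forall_le hV₂ hper₂ (C := c - H m) (fun x => by linarith [hl.min_add_le x]) x]
  exists_eq := by
    obtain ⟨x₁, hx₁⟩ := hl.exists_eq
    obtain ⟨x₂, hx₂⟩ := hper₂.exists_forall_le_of_continuous hV₂
    refine ⟨x₂, le_antisymm ?_ ?_⟩
    · linarith [h.forall_le hV₂ hper₂ (C := c - H m) (fun x => by linarith [hl.min_add_le x]) x₂]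
    · linarith [h.symm.forall_le hV₁ hper₁ hx₂ x₁]
  left_le := by
    rw [← h.integral_sub_eq hV₁ hV₂ (monotone_lowerBranch hcoer.tendsto_comp_neg)]
    exact hl.left_le
  le_right := by
    rw [← h.integral_sub_eq hV₁ hV₂ (monotone_lowerBranch hcoer.tendsto_atTop)]
    exact hl.le_right

/-- Every mean momentum belongs to the increasing branch, the decreasing branch or the flat part. -/
theorem exists_level (hH : Continuous H) (hcoer : Coercive H) (hanti : AntitoneOn H (Iic m))
    (hmono : MonotoneOn H (Ici m)) (hV : Continuous V) (hper : Function.Periodic V 1) (p : ℝ) :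
    ∃ c, IsRightLevel H m V p c ∨ IsRightLevel (fun q => H (-q)) (-m) V (-p) c ∨
      IsFlatLevel H m V p c := by
  obtain ⟨x₀, hx₀⟩ := hper.exists_forall_le_of_continuous hV
  have hle : ∀ x, H m + V x ≤ H m + V x₀ := fun x => by linarith [hx₀ x]
  by_cases h1 : ∫ x in (0 : ℝ)..1, lowerBranch H m (H m + V x₀ - V x) ≤ p
  · obtain ⟨c, hc⟩ := exists_isRightLevel hH hcoer.tendsto_atTop hmono hV hper hle h1
    exact ⟨c, Or.inl hc⟩
  by_cases h2 : ∫ x in (0 : ℝ)..1, lowerBranch (fun q => H (-q)) (-m) (H m + V x₀ - V x) ≤ -p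
  · obtain ⟨c, hc⟩ := exists_isRightLevel (hH.comp continuous_neg) hcoer.tendsto_comp_neg
      hanti.monotoneOn_comp_neg hV hper (by simpa using hle) h2
    exact ⟨c, Or.inr (Or.inl hc)⟩
  exact ⟨H m + V x₀, Or.inr (Or.inr ⟨hle, ⟨x₀, rfl⟩, by linarith, by linarith⟩)⟩

/-- A quasi-convex Hamiltonian sees the potential only through its distribution. -/
theorem effectiveHamiltonian_eq_of_sameDistribution (hH : Continuous H) (hcoer : Coercive H)
    (hq : QuasiconvexOn ℝ univ H) {V₁ V₂ : ℝ → ℝ} (hV₁ : Continuous V₁)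
    (hper₁ : Function.Periodic V₁ 1) (hV₂ : Continuous V₂) (hper₂ : Function.Periodic V₂ 1)
    (h : SameDistribution V₁ V₂) : effectiveHamiltonian H V₁ = effectiveHamiltonian H V₂ := by
  funext p
  obtain ⟨m, hanti, hmono⟩ := exists_antitoneOn_monotoneOn hH hcoer hq
  obtain ⟨c, hc | hc | hc⟩ := exists_level hH hcoer hanti hmono hV₁ hper₁ p
  · rw [hc.effectiveHamiltonian_eq hH hcoer hanti hmono hV₁ hper₁,
      (hc.congr_distribution hcoer.tendsto_atTop h hV₁ hV₂ hper₂).effectiveHamiltonian_eq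
        hH hcoer hanti hmono hV₂ hper₂]
  · rw [effectiveHamiltonian_eq_of_isRightLevel_neg hc hH hcoer hanti hmono hV₁ hper₁,
      effectiveHamiltonian_eq_of_isRightLevel_neg
        (hc.congr_distribution hcoer.tendsto_comp_neg h hV₁ hV₂ hper₂)
        hH hcoer hanti hmono hV₂ hper₂]
  · rw [hc.effectiveHamiltonian_eq hH hcoer hanti hmono hV₁ hper₁,
      (hc.congr_distribution hcoer h hV₁ hper₁ hV₂ hper₂).effectiveHamiltonian_eq
        hH hcoer hanti hmono hV₂ hper₂]

end EffectiveHamiltonian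

/-- For continuous `g` the corrector is a classical solution, and no assumption on `H` is needed. -/
theorem effectiveHamiltonian_eq_of_continuous {H V g : ℝ → ℝ} {p c : ℝ} (hg : Continuous g)
    (hper : Function.Periodic g 1) (hp : ∫ x in (0 : ℝ)..1, g x = p)
    (hc : ∀ x, H (g x) + V x = c) : effectiveHamiltonian H V p = c := by
  have hgi : ∀ a b, IntervalIntegrable g MeasureTheory.volume a b := hg.intervalIntegrable
  have hslope : ∀ φ : ℝ → ℝ, ContDiff ℝ 1 φ → ∀ x,
      IsLocalExtr (fun y => corrector g p y - φ y) x → p + deriv φ x = g x := by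
    intro φ hφ x hx
    have h := hx.hasDerivAt_eq_zero
      ((hasDerivAt_corrector hg x).sub (hφ.differentiable one_ne_zero x).hasDerivAt)
    linarith
  refine effectiveHamiltonian_eq (w := corrector g p) ⟨continuous_corrector hgi,
    periodic_corrector hgi hper hp, fun φ hφ x hx => ?_, fun φ hφ x hx => ?_⟩ fun c' w hw =>
    le_antisymm (hw.le_of_forall_le hg hper hp fun x => (hc x).le)
      (hw.ge_of_forall_ge hg hper hp fun x => (hc x).ge)
  · rw [hslope φ hφ x hx.isExtr, hc]
  · rw [hslope φ hφ x hx.isExtr, hc]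

/-- If `ψ` inverts `H` near `+∞`, then for large `c` the classical solution with momentum
`ψ (c - V)` shows that `∫ ψ (c - V)` is the mean momentum at which the effective Hamiltonian equals
`c`; equality of the effective Hamiltonians therefore gives equality of these averages. -/
theorem eventually_integral_eq {H ψ V₁ V₂ : ℝ → ℝ} {X : ℝ} (hψ : ContinuousOn ψ (Ici X))
    (hψtop : Tendsto ψ atTop atTop) (hinv : ∀ x, X ≤ x → H (ψ x) = x)
    (hV₁ : Continuous V₁) (hper₁ : Function.Periodic V₁ 1) (hV₂ : Continuous V₂)
    (hper₂ : Function.Periodic V₂ 1) (h : effectiveHamiltonian H V₁ = effectiveHamiltonian H V₂) :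
    ∀ᶠ c in atTop, ∫ x in (0 : ℝ)..1, ψ (c - V₁ x) = ∫ x in (0 : ℝ)..1, ψ (c - V₂ x) := by
  obtain ⟨x₁, hx₁⟩ := hper₁.exists_forall_le_of_continuous hV₁
  obtain ⟨x₂, hx₂⟩ := hper₂.exists_forall_le_of_continuous hV₂
  set c₀ := X + max (V₁ x₁) (V₂ x₂) with hc₀
  have hX₁ : ∀ c, c₀ ≤ c → ∀ x, X ≤ c - V₁ x := fun c hc x => by
    linarith [hx₁ x, le_max_left (V₁ x₁) (V₂ x₂)]
  have hX₂ : ∀ c, c₀ ≤ c → ∀ x, X ≤ c - V₂ x := fun c hc x => by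
    linarith [hx₂ x, le_max_right (V₁ x₁) (V₂ x₂)]
  have hcomp₁ : ∀ c, c₀ ≤ c → Continuous fun x => ψ (c - V₁ x) := fun c hc =>
    hψ.comp_continuous (by fun_prop) (hX₁ c hc)
  have hcomp₂ : ∀ c, c₀ ≤ c → Continuous fun x => ψ (c - V₂ x) := fun c hc =>
    hψ.comp_continuous (by fun_prop) (hX₂ c hc)
  have heff₁ : ∀ c, c₀ ≤ c →
      effectiveHamiltonian H V₁ (∫ x in (0 : ℝ)..1, ψ (c - V₁ x)) = c := fun c hc =>
    effectiveHamiltonian_eq_of_continuous (hcomp₁ c hc) (fun x => by simp only [hper₁ x]) rfl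
      fun x => by rw [hinv _ (hX₁ c hc x)]; ring
  have heff₂ : ∀ c, c₀ ≤ c →
      effectiveHamiltonian H V₂ (∫ x in (0 : ℝ)..1, ψ (c - V₂ x)) = c := fun c hc =>
    effectiveHamiltonian_eq_of_continuous (hcomp₂ c hc) (fun x => by simp only [hper₂ x]) rfl
      fun x => by rw [hinv _ (hX₂ c hc x)]; ring
  have htop : ∀ V : ℝ → ℝ, ∀ x₀, (∀ x, V x ≤ V x₀) →
      (∀ c, c₀ ≤ c → Continuous fun x => ψ (c - V x)) →
      Tendsto (fun c => ∫ x in (0 : ℝ)..1, ψ (c - V x)) atTop atTop := by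
    intro V x₀ hx₀ hcomp
    refine tendsto_atTop.2 fun b => ?_
    obtain ⟨Y, hY⟩ := eventually_atTop.1 (hψtop.eventually_ge_atTop b)
    filter_upwards [eventually_ge_atTop c₀, eventually_ge_atTop (Y + V x₀)] with c hc hcY
    have := intervalIntegral.integral_mono (μ := MeasureTheory.volume) (zero_le_one (α := ℝ))
      (intervalIntegrable_const (c := b)) ((hcomp c hc).intervalIntegrable 0 1)
      fun x => hY (c - V x) (by linarith [hx₀ x])
    simpa using this
  -- Beyond `X` the function `ψ` agrees with a function that is continuous on the whole line.
  have hext : Continuous fun c => ∫ x in (0 : ℝ)..1, ψ (max X (c - V₂ x)) := by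
    have : Continuous fun z => ψ (max X z) :=
      hψ.comp_continuous (by fun_prop) fun z => mem_Ici.2 (le_max_left _ _)
    exact intervalIntegral.continuous_parametric_intervalIntegral_of_continuous'
      (f := fun c x => ψ (max X (c - V₂ x))) (this.comp (show Continuous fun q : ℝ × ℝ => q.1 - V₂ q.2 by fun_prop)) 0 1
  have hcont : ContinuousOn (fun c => ∫ x in (0 : ℝ)..1, ψ (c - V₂ x)) (Ici c₀) :=
    hext.continuousOn.congr fun c hc => by simp only [max_eq_right (hX₂ c hc _)]
  filter_upwards [eventually_ge_atTop c₀, (htop V₁ x₁ hx₁ hcomp₁).eventually_ge_atTop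
    (∫ x in (0 : ℝ)..1, ψ (c₀ - V₂ x))] with c hc hge
  obtain ⟨d, hd, hdc⟩ := ((htop V₂ x₂ hx₂ hcomp₂).eventually_ge_atTop
    (∫ x in (0 : ℝ)..1, ψ (c - V₁ x)) |>.and (eventually_ge_atTop c₀)).exists
  obtain ⟨c', hc', heq⟩ := intermediate_value_Icc hdc (hcont.mono Icc_subset_Ici_self) ⟨hge, hd⟩
  have h1 := heff₂ c' hc'.1
  simp only at heq
  rw [heq, ← h, heff₁ c hc] at h1
  rw [← heq, h1]

/-! ### Slowly varying functions -/

/-- A function whose logarithmic derivative tends to `0` is slowly varying over bounded windows. -/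
theorem eventually_abs_le_two_mul_abs {f f' : ℝ → ℝ} (hf : ∀ᶠ x in atTop, HasDerivAt f (f' x) x)
    (hne : ∀ᶠ x in atTop, f x ≠ 0) (hlim : Tendsto (fun x => f' x / f x) atTop (𝓝 0))
    (L : ℝ) : ∀ᶠ c in atTop, ∀ ξ ∈ Icc c (c + L), |f ξ| ≤ 2 * |f c| := by
  have hlog : 0 < Real.log 2 := Real.log_pos one_lt_two
  set δ := Real.log 2 / (|L| + 1) with hδ
  have hδ0 : 0 < δ := by positivity
  have hsmall := hlim.abs.eventually (gt_mem_nhds (by simpa using hδ0))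
  obtain ⟨X, hX⟩ := eventually_atTop.1 ((hf.and hne).and hsmall)
  filter_upwards [eventually_ge_atTop X] with c hc ξ hξ
  have hmv := Convex.norm_image_sub_le_of_norm_hasDerivWithin_le
    (f := fun x => Real.log (f x)) (s := Ici c) (C := δ)
    (fun x hx => (((hX x (hc.trans hx)).1.1).log (hX x (hc.trans hx)).1.2).hasDerivWithinAt)
    (fun x hx => (hX x (hc.trans hx)).2.le) (convex_Ici c) self_mem_Ici hξ.1
  have hξc : ‖ξ - c‖ ≤ |L| + 1 := by
    rw [Real.norm_of_nonneg (by linarith [hξ.1])]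
    linarith [hξ.2, le_abs_self L]
  have hle : Real.log (f ξ) - Real.log (f c) ≤ Real.log 2 := by
    calc _ ≤ δ * ‖ξ - c‖ := (le_abs_self _).trans hmv
      _ ≤ δ * (|L| + 1) := by gcongr
      _ = Real.log 2 := by rw [hδ]; field_simp
  have h1 := abs_pos.2 (hX c hc).1.2
  have h2 := abs_pos.2 (hX ξ (hc.trans hξ.1)).1.2
  rw [← Real.log_abs (f ξ), ← Real.log_abs (f c)] at hle
  rw [← Real.log_le_log_iff h2 (by positivity), Real.log_mul two_ne_zero h1.ne']
  linarith

theorem ContDiffAt.hasDerivAt_iteratedDeriv {f : ℝ → ℝ} {n : ℕ} {x : ℝ}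
    (h : ContDiffAt ℝ ((n + 1 : ℕ) : WithTop ℕ∞) f x) :
    HasDerivAt (iteratedDeriv n f) (iteratedDeriv (n + 1) f x) x := by
  rw [iteratedDeriv_succ, hasDerivAt_deriv_iff, iteratedDeriv_eq_equiv_comp,
    LinearIsometryEquiv.comp_differentiableAt_iff]
  exact h.differentiableAt_iteratedFDeriv (by exact_mod_cast Nat.lt_succ_self n)

/-! ### Moments from averages of a slowly varying function -/

section Moments

variable {ψ : ℝ → ℝ}

/-- Taylor expansion of `ψ` on the windows `[c, c + L]`: the remainder is negligible compared with
the last derivative that is kept. -/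
theorem eventually_taylor_remainder_le (n : ℕ)
    (hdiff : ∀ᶠ x in atTop, ContDiffAt ℝ ((n + 1 : ℕ) : WithTop ℕ∞) ψ x)
    (hne : ∀ᶠ x in atTop, iteratedDeriv n ψ x ≠ 0)
    (hlim : Tendsto (fun x => iteratedDeriv (n + 1) ψ x / iteratedDeriv n ψ x) atTop (𝓝 0))
    {L : ℝ} (hL : 0 < L) {ε : ℝ} (hε : 0 < ε) :
    ∀ᶠ c in atTop, ∀ w ∈ Icc 0 L,
      |ψ (c + w) - ∑ k ∈ Finset.range (n + 1), iteratedDeriv k ψ c / k.factorial * w ^ k| ≤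
        ε * |iteratedDeriv n ψ c| := by
  have hslow := eventually_abs_le_two_mul_abs
    (hdiff.mono fun x hx => hx.hasDerivAt_iteratedDeriv) hne hlim L
  set δ := ε / (2 * L ^ (n + 1)) with hδ
  have hδ0 : 0 < δ := by positivity
  have hδL : δ * (2 * L ^ (n + 1)) = ε := by rw [hδ]; field_simp
  have hsmall := hlim.abs.eventually (gt_mem_nhds (by simpa using hδ0))
  obtain ⟨X, hX⟩ := eventually_atTop.1 ((hdiff.and hne).and hsmall)
  filter_upwards [eventually_ge_atTop X, hslow] with c hc hslow w hw
  have hdiffc : ∀ y ∈ Icc c (c + L), ContDiffAt ℝ ((n + 1 : ℕ) : WithTop ℕ∞) ψ y := fun y hy =>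
    (hX y (hc.trans hy.1)).1.1
  have hu : UniqueDiffOn ℝ (Icc c (c + L)) := uniqueDiffOn_Icc (by linarith)
  have hder : ∀ k ≤ n + 1, ∀ y ∈ Icc c (c + L),
      iteratedDerivWithin k ψ (Icc c (c + L)) y = iteratedDeriv k ψ y := fun k hk y hy =>
    iteratedDerivWithin_eq_iteratedDeriv hu ((hdiffc y hy).of_le (by exact_mod_cast hk)) hy
  have hbound := taylor_mean_remainder_bound (f := ψ) (n := n)
    (C := δ * (2 * |iteratedDeriv n ψ c|)) (show c ≤ c + L by linarith)
    (fun y hy => by simpa using (hdiffc y hy).contDiffWithinAt)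
    (show c + w ∈ Icc c (c + L) from ⟨by linarith [hw.1], by linarith [hw.2]⟩) fun y hy => by
      have hy' := hX y (hc.trans hy.1)
      rw [hder _ le_rfl y hy, Real.norm_eq_abs]
      have h1 := hy'.2.le
      rw [abs_div, div_le_iff₀ (abs_pos.2 hy'.1.2)] at h1
      exact h1.trans (mul_le_mul_of_nonneg_left (hslow y hy) hδ0.le)
  have hsum : taylorWithinEval ψ n (Icc c (c + L)) c (c + w) =
      ∑ k ∈ Finset.range (n + 1), iteratedDeriv k ψ c / k.factorial * w ^ k := by
    rw [taylor_within_apply]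
    refine Finset.sum_congr rfl fun k hk => ?_
    rw [hder k (Finset.mem_range.1 hk).le c ⟨le_rfl, by linarith⟩, smul_eq_mul]
    ring
  rw [hsum, Real.norm_eq_abs, add_sub_cancel_left] at hbound
  refine hbound.trans ?_
  have hfac : (1 : ℝ) ≤ n.factorial := by exact_mod_cast n.factorial_pos
  calc δ * (2 * |iteratedDeriv n ψ c|) * w ^ (n + 1) / n.factorial
      ≤ δ * (2 * |iteratedDeriv n ψ c|) * w ^ (n + 1) := div_le_self
        (by have := hw.1; positivity) hfac
    _ ≤ δ * (2 * |iteratedDeriv n ψ c|) * L ^ (n + 1) := by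
        have := hw.1
        have := hw.2
        gcongr
    _ = ε * |iteratedDeriv n ψ c| := by rw [← hδL]; ring

/-- If the averages of `ψ` along all large translates agree, so do all moments: once the moments
below `n` agree, the Taylor expansion of order `n` turns the equality of the averages into
smallness of the difference of the `n`-th moments. -/
theorem integral_pow_eq_of_eventually_integral_eq
    (hψ : ∀ k : ℕ, 1 ≤ k →
      (∀ᶠ x in atTop, ContDiffAt ℝ k ψ x ∧ iteratedDeriv (k - 1) ψ x ≠ 0) ∧
      Tendsto (fun x => iteratedDeriv k ψ x / iteratedDeriv (k - 1) ψ x) atTop (𝓝 0))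
    {W₁ W₂ : ℝ → ℝ} (hW₁ : Continuous W₁) (hW₂ : Continuous W₂) {L : ℝ} (hL : 0 < L)
    (h₁ : ∀ x, W₁ x ∈ Icc 0 L) (h₂ : ∀ x, W₂ x ∈ Icc 0 L)
    (h : ∀ᶠ c in atTop, ∫ x in (0 : ℝ)..1, ψ (c + W₁ x) = ∫ x in (0 : ℝ)..1, ψ (c + W₂ x))
    (n : ℕ) : ∫ x in (0 : ℝ)..1, W₁ x ^ n = ∫ x in (0 : ℝ)..1, W₂ x ^ n := by
  induction n using Nat.strong_induction_on with
  | _ n ih =>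
  obtain ⟨hreg, hlim⟩ := hψ (n + 1) (by omega)
  rw [Nat.add_sub_cancel] at hlim
  have hdiff := hreg.mono fun x hx => hx.1
  have hne : ∀ᶠ x in atTop, iteratedDeriv n ψ x ≠ 0 := hreg.mono fun x hx => hx.2
  refine eq_of_abs_sub_le_all fun ε hε => ?_
  have hfac : (0 : ℝ) < n.factorial := by exact_mod_cast n.factorial_pos
  obtain ⟨X, hX⟩ := eventually_atTop.1 hdiff
  obtain ⟨c, ⟨⟨hc, hrem⟩, hnec⟩, hcX⟩ := (((h.and (eventually_taylor_remainder_le n hdiff hne hlim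
    hL (show 0 < ε / (2 * n.factorial) by positivity))).and hne).and
    (eventually_ge_atTop X)).exists
  set a : ℕ → ℝ := fun k => iteratedDeriv k ψ c / k.factorial with ha
  set R := ε / (2 * n.factorial) * |iteratedDeriv n ψ c| with hR
  have hψc : ContinuousOn ψ (Ici X) := fun x hx => (hX x hx).continuousAt.continuousWithinAt
  have key : ∀ W : ℝ → ℝ, Continuous W → (∀ x, W x ∈ Icc 0 L) →
      |(∫ x in (0 : ℝ)..1, ψ (c + W x)) -
        ∑ k ∈ Finset.range (n + 1), a k * ∫ x in (0 : ℝ)..1, W x ^ k| ≤ R := by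
    intro W hW hWL
    have hcomp : Continuous fun x => ψ (c + W x) :=
      hψc.comp_continuous (by fun_prop) fun x => by
        have := (hWL x).1
        simp only [mem_Ici]; linarith
    have hsum : ∑ k ∈ Finset.range (n + 1), a k * ∫ x in (0 : ℝ)..1, W x ^ k =
        ∫ x in (0 : ℝ)..1, ∑ k ∈ Finset.range (n + 1), a k * W x ^ k := by
      rw [intervalIntegral.integral_finsetSum fun k _ =>
        Continuous.intervalIntegrable (by fun_prop) _ _]
      simp only [intervalIntegral.integral_const_mul]
    rw [hsum, ← intervalIntegral.integral_sub (hcomp.intervalIntegrable _ _)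
      (Continuous.intervalIntegrable (by fun_prop) _ _)]
    have := intervalIntegral.norm_integral_le_of_norm_le_const (a := (0 : ℝ)) (b := 1) (C := R)
      (f := fun x => ψ (c + W x) - ∑ k ∈ Finset.range (n + 1), a k * W x ^ k)
      fun x _ => hrem (W x) (hWL x)
    simpa using this
  have k₁ := key W₁ hW₁ h₁
  have k₂ := key W₂ hW₂ h₂
  -- By induction the two Taylor sums differ in their last term only.
  have hlow : ∑ k ∈ Finset.range n, a k * ∫ x in (0 : ℝ)..1, W₁ x ^ k =
      ∑ k ∈ Finset.range n, a k * ∫ x in (0 : ℝ)..1, W₂ x ^ k :=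
    Finset.sum_congr rfl fun k hk => by rw [ih k (Finset.mem_range.1 hk)]
  rw [Finset.sum_range_succ, hlow, hc] at k₁
  rw [Finset.sum_range_succ] at k₂
  rw [abs_le] at k₁ k₂
  have hdiff' : |a n * ((∫ x in (0 : ℝ)..1, W₁ x ^ n) - ∫ x in (0 : ℝ)..1, W₂ x ^ n)| ≤ 2 * R := by
    rw [abs_le]
    constructor <;> linarith [k₁.1, k₁.2, k₂.1, k₂.2]
  have hRa : 2 * R = |a n| * ε := by
    rw [hR, ha, abs_div, Nat.abs_cast]
    field_simp
  have hapos : 0 < |a n| := abs_pos.2 (div_ne_zero hnec hfac.ne')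
  rw [abs_mul, hRa] at hdiff'
  exact le_of_mul_le_mul_left hdiff' hapos

/-- Bounded functions with equal moments have equal distribution, by the Weierstrass approximation
theorem. -/
theorem integral_comp_eq_of_integral_pow_eq {W₁ W₂ : ℝ → ℝ} (hW₁ : Continuous W₁)
    (hW₂ : Continuous W₂) {L : ℝ} (h₁ : ∀ x, W₁ x ∈ Icc 0 L) (h₂ : ∀ x, W₂ x ∈ Icc 0 L)
    (h : ∀ n : ℕ, ∫ x in (0 : ℝ)..1, W₁ x ^ n = ∫ x in (0 : ℝ)..1, W₂ x ^ n)
    {f : ℝ → ℝ} (hf : Continuous f) :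
    ∫ x in (0 : ℝ)..1, f (W₁ x) = ∫ x in (0 : ℝ)..1, f (W₂ x) := by
  refine eq_of_abs_sub_le_all fun ε hε => ?_
  obtain ⟨P, hP⟩ := exists_polynomial_near_of_continuousOn 0 L f hf.continuousOn (ε / 2)
    (by positivity)
  have hpoly : ∀ W : ℝ → ℝ, Continuous W → ∫ x in (0 : ℝ)..1, P.eval (W x) =
      ∑ k ∈ Finset.range (P.natDegree + 1), P.coeff k * ∫ x in (0 : ℝ)..1, W x ^ k := by
    intro W hW
    simp only [Polynomial.eval_eq_sum_range]
    rw [intervalIntegral.integral_finsetSum fun k _ =>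
      Continuous.intervalIntegrable (by fun_prop) _ _]
    simp only [intervalIntegral.integral_const_mul]
  have key : ∀ W : ℝ → ℝ, Continuous W → (∀ x, W x ∈ Icc 0 L) →
      |(∫ x in (0 : ℝ)..1, P.eval (W x)) - ∫ x in (0 : ℝ)..1, f (W x)| ≤ ε / 2 := by
    intro W hW hWL
    have hPW : Continuous fun x => P.eval (W x) := P.continuous.comp hW
    have hfW : Continuous fun x => f (W x) := hf.comp hW
    rw [← intervalIntegral.integral_sub (hPW.intervalIntegrable _ _) (hfW.intervalIntegrable _ _)]
    have := intervalIntegral.norm_integral_le_of_norm_le_const (a := (0 : ℝ)) (b := 1) (C := ε / 2)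
      (f := fun x => P.eval (W x) - f (W x)) fun x _ => (hP (W x) (hWL x)).le
    simpa using this
  have k₁ := key W₁ hW₁ h₁
  have k₂ := key W₂ hW₂ h₂
  rw [hpoly W₁ hW₁, Finset.sum_congr rfl fun k _ => by rw [h k], ← hpoly W₂ hW₂] at k₁
  rw [abs_le] at k₁ k₂ ⊢
  constructor <;> linarith [k₁.1, k₁.2, k₂.1, k₂.2]

end Moments

/-! ### Strongly superlinear Hamiltonians -/

section BranchInverse

variable {H : ℝ → ℝ} {a : ℝ}

theorem apply_branchInverse (hsurj : SurjOn H (Ici a) (Ici (H a))) {x : ℝ} (hx : H a ≤ x) :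
    H (branchInverse H a x) = x :=
  Function.invFunOn_eq (hsurj hx)

theorem tendsto_branchInverse (hmono : StrictMonoOn H (Ici a))
    (hsurj : SurjOn H (Ici a) (Ici (H a))) : Tendsto (branchInverse H a) atTop atTop := by
  refine tendsto_atTop.2 fun b => ?_
  filter_upwards [eventually_ge_atTop (H a), eventually_ge_atTop (H (max a b))] with x hx hxb
  refine (le_max_right a b).trans ((hmono.le_iff_le (le_max_left a b)
    (Function.invFunOn_mem (hsurj hx))).1 ?_)
  exact hxb.trans_eq (apply_branchInverse hsurj hx).symm

end BranchInverse

/-- A strongly superlinear Hamiltonian determines the distribution of the potential. -/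
theorem StronglySuperlinear.sameDistribution {H V₁ V₂ : ℝ → ℝ} (hs : StronglySuperlinear H)
    (hV₁ : Continuous V₁) (hper₁ : Function.Periodic V₁ 1) (hV₂ : Continuous V₂)
    (hper₂ : Function.Periodic V₂ 1) (h : effectiveHamiltonian H V₁ = effectiveHamiltonian H V₂) :
    SameDistribution V₁ V₂ := by
  obtain ⟨a, -, hmono, hsurj, hψ⟩ := hs
  obtain ⟨X, hX⟩ := eventually_atTop.1 (hψ 1 le_rfl).1
  have hcont : ContinuousOn (branchInverse H a) (Ici (max X (H a))) := fun x hx =>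
    (hX x ((le_max_left _ _).trans hx)).1.continuousAt.continuousWithinAt
  have hev := eventually_integral_eq hcont (tendsto_branchInverse hmono hsurj)
    (fun x hx => apply_branchInverse hsurj ((le_max_right _ _).trans hx)) hV₁ hper₁ hV₂ hper₂ h
  obtain ⟨x₁, hx₁⟩ := hper₁.exists_forall_le_of_continuous hV₁
  obtain ⟨x₂, hx₂⟩ := hper₂.exists_forall_le_of_continuous hV₂
  obtain ⟨y₁, hy₁⟩ := Function.Periodic.exists_forall_le_of_continuous (f := -V₁) hV₁.neg
    fun x => by simp [hper₁ x]
  obtain ⟨y₂, hy₂⟩ := Function.Periodic.exists_forall_le_of_continuous (f := -V₂) hV₂.neg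
    fun x => by simp [hper₂ x]
  simp only [Pi.neg_apply] at hy₁ hy₂
  -- The shifts `M - Vᵢ` are nonnegative, so that Taylor expansions to the right of `c` suffice.
  set M := max (V₁ x₁) (V₂ x₂) with hM
  set N := max (-V₁ y₁) (-V₂ y₂) with hN
  have hM₁ := le_max_left (V₁ x₁) (V₂ x₂)
  have hM₂ := le_max_right (V₁ x₁) (V₂ x₂)
  have hN₁ := le_max_left (-V₁ y₁) (-V₂ y₂)
  have hN₂ := le_max_right (-V₁ y₁) (-V₂ y₂)
  have hMN : 0 ≤ M + N := by linarith [hx₁ y₁]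
  have h₁ : ∀ x, M - V₁ x ∈ Icc 0 (M + N + 1) := fun x =>
    ⟨by linarith [hx₁ x], by linarith [hy₁ x]⟩
  have h₂ : ∀ x, M - V₂ x ∈ Icc 0 (M + N + 1) := fun x =>
    ⟨by linarith [hx₂ x], by linarith [hy₂ x]⟩
  have hev' : ∀ᶠ c in atTop, ∫ x in (0 : ℝ)..1, branchInverse H a (c + (M - V₁ x)) =
      ∫ x in (0 : ℝ)..1, branchInverse H a (c + (M - V₂ x)) := by
    filter_upwards [(tendsto_atTop_add_const_right atTop M tendsto_id).eventually hev] with c hc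
    simpa only [id_eq, add_sub_assoc] using hc
  intro f hf
  have := integral_comp_eq_of_integral_pow_eq (by fun_prop) (by fun_prop) h₁ h₂
    (integral_pow_eq_of_eventually_integral_eq hψ (by fun_prop) (by fun_prop) (by linarith)
      h₁ h₂ hev') (f := fun w => f (M - w)) (by fun_prop)
  simpa using this

theorem theorem1p3 (H : ℝ → ℝ) (hH : Continuous H) (hcoer : Coercive H)
    (V₁ V₂ : ℝ → ℝ) (hV₁ : Continuous V₁) (hV₁per : Function.Periodic V₁ 1)
    (hV₂ : Continuous V₂) (hV₂per : Function.Periodic V₂ 1) :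
    (QuasiconvexOn ℝ Set.univ H → SameDistribution V₁ V₂ →
      effectiveHamiltonian H V₁ = effectiveHamiltonian H V₂) ∧
    (StronglySuperlinear H → effectiveHamiltonian H V₁ = effectiveHamiltonian H V₂ →
      SameDistribution V₁ V₂) :=
  ⟨fun hq h => effectiveHamiltonian_eq_of_sameDistribution hH hcoer hq hV₁ hV₁per hV₂ hV₂per h,
    fun hs h => hs.sameDistribution hV₁ hV₁per hV₂ hV₂per h⟩
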